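/- Let $g,d\ge 1$. For a tuple $A=(A_1,\dots,A_g)\in M_d(\mathbb C)^g$ and $X=(X_1,\dots,X_g)\in M_n(\mathbb C)^g$ put $\Lambda_A(X)=\sum_{s=1}^g A_s\otimes X_s$ and $L_A(X)=I_{dn}-\Lambda_A(X)-\Lambda_A(X)^*$. The free spectrahedron of $A$ is the sequence $\mathcal D_A=(\mathcal D_A[n])_n$, where $\mathcal D_A[n]=\{X\in M_n(\mathbb C)^g : L_A(X)\succeq 0\}$. It is *Reinhardt* if $(\gamma_1X_1,\dots,\gamma_gX_g)\in\mathcal D_A[n]$ for all $n$, all $X\in\mathcal D_A[n]$ and all $\gamma\in\mathbb T^g$, where $\mathbb T$ is the unit circle in $\mathbb C$. The tuple $A\in M_d(\mathbb C)^g$ is a *minimal defining tuple* for $\mathcal D_A$ if $d'\ge d$ for every $d'$ and every $B\in M_{d'}(\mathbb C)^g$ with $\mathcal D_B=\mathcal D_A$. **Theorem.** Suppose $A\in M_d(\mathbb C)^g$ is a minimal defining tuple for $\mathcal D_A$ and $A_s\neq 0$ for each $s$. Then $\mathcal D_A$ is Reinhardt if and only if there is an orthogonal decomposition $\mathbb C^d=\bigoplus_{\ell=1}^m\mathcal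 H_\ell$ such that, writing $A_s=(A_s(j,k))_{j,k=1}^m$ with respect to this decomposition, where $A_s(j,k):\mathcal H_k\to\mathcal H_j$, and putting $V=\{1,\dots,m\}$, $I_s^+=\{(j,k)\in V\times V : A_s(j,k)\neq 0\}$ and $E^+=\bigcup_{s=1}^g I_s^+$, the following hold: 1. the directed graph $(V,E^+)$ is acyclic (in particular it has no loops); 2. $\{I_1^+,\dots,I_g^+\}$ is a Reinhardt partition of $E^+$; that is, $I_s^+\cap I_t^+=\varnothing$ for $s\ne t$, and for every cycle $L$ of the underlying undirected graph (edges of $E^+$ may be traversed in either direction) and every $s$, the number of edges of $I_s^+$ that $L$ traverses in the forward direction equals the number of edges of $I_s^+$ that it traverses in the backward direction. -/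

import Mathlib

open scoped ComplexOrder Kronecker

noncomputable section

namespace FreeReinhardt

/-- The evaluation `Λ_A(X) = ∑ₛ Aₛ ⊗ Xₛ` of the homogeneous linear matrix polynomial of `A`. -/
def linPart {g d n : ℕ} (A : Fin g → Matrix (Fin d) (Fin d) ℂ)
    (X : Fin g → Matrix (Fin n) (Fin n) ℂ) : Matrix (Fin d × Fin n) (Fin d × Fin n) ℂ :=
  ∑ s, A s ⊗ₖ X s

/-- The evaluation `L_A(X) = I - Λ_A(X) - Λ_A(X)^*` of the monic linear pencil of `A`. -/
def pencil {g d n : ℕ} (A : Fin g → Matrix (Fin d) (Fin d) ℂ)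
    (X : Fin g → Matrix (Fin n) (Fin n) ℂ) : Matrix (Fin d × Fin n) (Fin d × Fin n) ℂ :=
  1 - linPart A X - (linPart A X).conjTranspose

/-- The free spectrahedron `D_A = (D_A[n])ₙ` with `D_A[n] = {X : L_A(X) ⪰ 0}`. -/
def freeSpectrahedron {g d : ℕ} (A : Fin g → Matrix (Fin d) (Fin d) ℂ) :
    (n : ℕ) → Set (Fin g → Matrix (Fin n) (Fin n) ℂ) :=
  fun _ => {X | (pencil A X).PosSemidef}

/-- A graded set of `g`-tuples of matrices is Reinhardt if it is invariant, at every level, under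
the coordinatewise action of the torus `𝕋^g`. -/
def IsReinhardt {g : ℕ} (D : (n : ℕ) → Set (Fin g → Matrix (Fin n) (Fin n) ℂ)) : Prop :=
  ∀ (n : ℕ), ∀ X ∈ D n, ∀ γ : Fin g → Circle, (fun s => (γ s : ℂ) • X s) ∈ D n

/-- `A` is a defining tuple of `D` of the least possible size. -/
def IsMinimalDefiningTuple {g d : ℕ} (A : Fin g → Matrix (Fin d) (Fin d) ℂ)
    (D : (n : ℕ) → Set (Fin g → Matrix (Fin n) (Fin n) ℂ)) : Prop :=
  D = freeSpectrahedron A ∧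
    ∀ (d' : ℕ) (B : Fin g → Matrix (Fin d') (Fin d') ℂ), D = freeSpectrahedron B → d ≤ d'

/-- The directed graph with edge set `E` is a dag: no vertex can be reached from itself along a
directed path of length at least one (in particular there are no loops). -/
def IsDag {V : Type*} (E : Set (V × V)) : Prop :=
  ∀ v, ¬ Relation.TransGen (fun a b => (a, b) ∈ E) v v

/-- The undirected graph `(V, E⁺ ∪ E⁻)` underlying the directed graph with edge set `E = E⁺`. -/
def undirected {V : Type*} (E : Set (V × V)) : SimpleGraph V :=
  SimpleGraph.fromRel (fun a b => (a, b) ∈ E)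

open Classical in
/-- A closed walk is neutral for the family `P` if, for each `s`, it traverses as many edges of
`P s` in the forward direction as in the backward direction. -/
def IsNeutral {V ι : Type*} {G : SimpleGraph V} (P : ι → Set (V × V)) {v : V}
    (L : G.Walk v v) : Prop :=
  ∀ s, L.darts.countP (fun e => (e.fst, e.snd) ∈ P s) =
    L.darts.countP (fun e => (e.snd, e.fst) ∈ P s)

/-- The family `P` is a partition of the edge set `E` of a directed graph for which all the cycles
of the underlying undirected graph are neutral. -/
structure IsReinhardtPartition {V ι : Type*} (E : Set (V × V)) (P : ι → Set (V × V)) : Prop where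
  disjoint : ∀ s t, s ≠ t → Disjoint (P s) (P t)
  union : ⋃ s, P s = E
  neutral : ∀ (v : V) (L : (undirected E).Walk v v), L.IsCycle → IsNeutral P L

/-- `ℂ^d` is the orthogonal direct sum of the subspaces `H ℓ`. -/
structure IsOrthogonalDecomposition {d m : ℕ}
    (H : Fin m → Submodule ℂ (EuclideanSpace ℂ (Fin d))) : Prop where
  orthogonal : ∀ j k, j ≠ k → H j ⟂ H k
  span : ⨆ l, H l = ⊤

/-- The block `M(j,k) : H k → H j`, the compression of the operator `M` on `ℂ^d`. -/
def block {d m : ℕ} (H : Fin m → Submodule ℂ (EuclideanSpace ℂ (Fin d)))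
    (M : Matrix (Fin d) (Fin d) ℂ) (j k : Fin m) : H k →L[ℂ] H j :=
  (H j).orthogonalProjectionOnto ∘L Matrix.toEuclideanCLM (𝕜 := ℂ) M ∘L (H k).subtypeL

/-- The set of pairs `(j,k)` for which the block `M(j,k)` does not vanish. -/
def blockPattern {d m : ℕ} (H : Fin m → Submodule ℂ (EuclideanSpace ℂ (Fin d)))
    (M : Matrix (Fin d) (Fin d) ℂ) : Set (Fin m × Fin m) :=
  {p | block H M p.1 p.2 ≠ 0}

end FreeReinhardt

end

/-! Both conditions are linked by unitaries `U` with `A s * U = γ s • (U * A s)`. Such a `U` makes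
`γA` unitarily equivalent to `A`, so if one exists for every `γ`, the free spectrahedron is
Reinhardt. Spectrally, `U` is an orthogonal decomposition with a unimodular number `θ k` on each
summand, and the intertwining relation says exactly that `θ k = γ s * θ j` whenever the block `A s
(j,k)` is nonzero: `θ` is a multiplicative potential on the graph.

From the graph to Reinhardt: neutrality of cycles gives every closed walk weight one, so for each
`γ` a potential is defined by weights of walks from base points
(`IsReinhardtPartition.exists_potential`), and `U` is the sum of the `θ k` times the projections.

From Reinhardt to the graph: one multiplicatively independent `γ` suffices, since the potential
forces the product of `γ s` to the power (forward minus backward edges) to be one along every closed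
walk, so all exponents vanish. The work is to find `U`. A Hahn-Banach argument on Choi matrices
gives a unital completely positive map `Φ` with `Φ(A s) = γ s • A s` (`IsReinhardt.exists_kraus`).
Minimality makes every `h ⪰ 0` with `h ⪯ Φ(h)` a fixed point (`krausMap_eq_of_le`): otherwise the
compression to the kernel of `Φ(h) - h` would define the same set, because the error terms `Φ^k(Φ(h)
- h)` become small while the rotation by `γ^k` can be undone. The Schwarz inequality applies this to
`h = (A s)ᴴ * A s` and its counterpart for the adjoint, so its defect is zero and each Kraus
operator intertwines (`kraus_intertwines`). Finally, minimality forbids square-zero elements in the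
commutant, and a partially isometric intertwiner with minimal kernel is then unitary
(`exists_unitary_intertwiner`). -/

namespace FreeReinhardt

/-! ### Spectral projections of Hermitian matrices -/

section SpectralProjections

open Matrix

variable {d : ℕ}

/-- A Hermitian matrix is unitarily diagonalizable with real eigenvalues. -/
theorem exists_unitary_diagonal {H : Matrix (Fin d) (Fin d) ℂ} (hH : H.IsHermitian) :
    ∃ (U : Matrix (Fin d) (Fin d) ℂ) (a : Fin d → ℝ), Uᴴ * U = 1 ∧ U * Uᴴ = 1 ∧
      H = U * diagonal (fun i => (a i : ℂ)) * Uᴴ := by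
  refine ⟨hH.eigenvectorUnitary, hH.eigenvalues, ?_, ?_, ?_⟩
  · exact Unitary.coe_star_mul_self hH.eigenvectorUnitary
  · exact Unitary.coe_mul_star_self hH.eigenvectorUnitary
  · have := hH.spectral_theorem
    rw [Unitary.conjStarAlgAut_apply] at this
    exact this

/-- The spectral projection of a Hermitian matrix for one real number. -/
theorem exists_spectral_projection {H : Matrix (Fin d) (Fin d) ℂ} (hH : H.IsHermitian) (μ : ℝ) :
    ∃ P : Matrix (Fin d) (Fin d) ℂ, Pᴴ = P ∧ P * P = P ∧ H * P = (μ : ℂ) • P ∧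
      (∀ v : Fin d → ℂ, H *ᵥ v = (μ : ℂ) • v → P *ᵥ v = v) ∧
      ∀ B, B * H = H * B → B * P = P * B := by
  obtain ⟨U, a, h1, h2, rfl⟩ := exists_unitary_diagonal hH
  set e : Fin d → ℂ := fun i => if a i = μ then 1 else 0 with he
  have key : ∀ x y : Matrix (Fin d) (Fin d) ℂ, (U * x * Uᴴ) * (U * y * Uᴴ) = U * (x * y) * Uᴴ := by
    intro x y
    calc (U * x * Uᴴ) * (U * y * Uᴴ) = U * x * (Uᴴ * U) * y * Uᴴ := by simp only [mul_assoc]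
      _ = _ := by rw [h1]; simp only [mul_assoc, mul_one]
  refine ⟨U * diagonal e * Uᴴ, ?_, ?_, ?_, ?_, ?_⟩
  · simp only [conjTranspose_mul, conjTranspose_conjTranspose, diagonal_conjTranspose, mul_assoc]
    congr 3
    ext i
    simp only [he, Pi.star_apply]
    split_ifs <;> simp
  · rw [key, diagonal_mul_diagonal]
    congr 3
    ext i
    simp [he]
  · rw [key, diagonal_mul_diagonal, ← Matrix.smul_mul, ← Matrix.mul_smul, ← diagonal_smul]
    congr 3
    ext i
    by_cases h : a i = μ <;> simp [he, h]
  · intro v hv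
    have hv' : diagonal (fun i => (a i : ℂ)) *ᵥ (Uᴴ *ᵥ v) = (μ : ℂ) • (Uᴴ *ᵥ v) := by
      have := congrArg (Uᴴ *ᵥ ·) hv
      simp only [mulVec_mulVec, mulVec_smul] at this
      rw [← this, mulVec_mulVec]
      congr 1
      simp only [← mul_assoc, h1, one_mul]
    have hd : diagonal e *ᵥ (Uᴴ *ᵥ v) = Uᴴ *ᵥ v := by
      ext i
      have := congrFun hv' i
      rw [mulVec_diagonal, Pi.smul_apply, smul_eq_mul, ← sub_eq_zero, ← sub_mul] at this
      rw [mulVec_diagonal]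
      by_cases h : a i = μ
      · simp [he, h]
      · have h' : (a i : ℂ) - μ ≠ 0 := by
          rw [sub_ne_zero]; exact_mod_cast h
        have h0 := (mul_eq_zero.mp this).resolve_left h'
        rw [h0]; simp
    rw [mul_assoc, ← mulVec_mulVec, ← mulVec_mulVec, hd, mulVec_mulVec, h2, one_mulVec]
  · intro B hB
    set C := Uᴴ * B * U with hC
    have hBC : B = U * C * Uᴴ := by
      rw [hC]
      calc B = (U * Uᴴ) * B * (U * Uᴴ) := by rw [h2]; simp
        _ = _ := by simp only [mul_assoc]
    have inj : ∀ x y : Matrix (Fin d) (Fin d) ℂ, U * x * Uᴴ = U * y * Uᴴ → x = y := by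
      intro x y h
      have := congrArg (fun z => Uᴴ * z * U) h
      have aux : ∀ x : Matrix (Fin d) (Fin d) ℂ, Uᴴ * (U * x * Uᴴ) * U = x := by
        intro x
        calc _ = (Uᴴ * U) * x * (Uᴴ * U) := by simp only [mul_assoc]
          _ = x := by rw [h1]; simp
      simpa only [aux] using this
    rw [hBC, key, key] at hB
    have hCD := inj _ _ hB
    rw [hBC, key, key]
    congr 2
    ext i j
    have := congrFun (congrFun hCD i) j
    rw [mul_diagonal, diagonal_mul] at this
    rw [mul_diagonal, diagonal_mul]
    -- Commutation with the diagonal matrix of the `a i` kills the entries of `C` between different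
    -- eigenvalues, and `e` is constant on equal ones.
    by_cases h : a i = a j
    · simp only [he, h, mul_comm]
    · have h' : (a j : ℂ) - a i ≠ 0 := by
        rw [sub_ne_zero]; exact_mod_cast Ne.symm h
      have h0 : C i j = 0 := by
        have : C i j * ((a j : ℂ) - a i) = 0 := by rw [mul_sub, this]; ring
        exact (mul_eq_zero.mp this).resolve_right h'
      simp [h0]

/-- The range of a proper orthogonal projection is the range of an isometry from a smaller space. -/
theorem exists_isometry_of_projection {Q : Matrix (Fin d) (Fin d) ℂ} (hQ : Qᴴ = Q)
    (hQ2 : Q * Q = Q) (hne : Q ≠ 1) :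
    ∃ (d' : ℕ) (J : Matrix (Fin d) (Fin d') ℂ), d' < d ∧ Jᴴ * J = 1 ∧ J * Jᴴ = Q := by
  obtain ⟨U, a, h1, h2, h3⟩ := exists_unitary_diagonal (H := Q) hQ
  have ha : ∀ i, a i = 0 ∨ a i = 1 := by
    intro i
    have h4 : Uᴴ * Q * U = diagonal (fun i => (a i : ℂ)) := by
      rw [h3]
      calc _ = (Uᴴ * U) * diagonal (fun i => (a i : ℂ)) * (Uᴴ * U) := by simp only [mul_assoc]
        _ = _ := by rw [h1]; simp
    have h5 : diagonal (fun i => (a i : ℂ)) * diagonal (fun i => (a i : ℂ))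
        = diagonal (fun i => (a i : ℂ)) := by
      rw [← h4]
      calc _ = Uᴴ * Q * (U * Uᴴ) * Q * U := by simp only [mul_assoc]
        _ = Uᴴ * (Q * Q) * U := by rw [h2]; simp only [mul_assoc, mul_one]
        _ = _ := by rw [hQ2]
    rw [diagonal_mul_diagonal] at h5
    have h6 := congrFun (diagonal_injective h5) i
    have h7 : a i * a i = a i := by exact_mod_cast h6
    have : a i * (a i - 1) = 0 := by linarith
    rcases mul_eq_zero.mp this with h | h
    · exact Or.inl h
    · exact Or.inr (by linarith)
  let S := {i : Fin d // a i = 1}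
  have hcard : Fintype.card S < d := by
    have : ∃ i, ¬ a i = 1 := by
      by_contra hcon
      push Not at hcon
      apply hne
      rw [h3]
      have : (fun i => (a i : ℂ)) = fun _ => 1 := by ext i; simp [hcon i]
      rw [this, diagonal_one, mul_one, h2]
    obtain ⟨i, hi⟩ := this
    simpa using Fintype.card_subtype_lt (p := fun i => a i = 1) hi
  let e : Fin (Fintype.card S) ≃ S := (Fintype.equivFin S).symm
  refine ⟨Fintype.card S, U.submatrix id (fun k => (e k : Fin d)), hcard, ?_, ?_⟩
  · ext k l
    have := congrFun (congrFun h1 (e k)) (e l)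
    simp only [mul_apply, conjTranspose_apply] at this
    simp only [mul_apply, conjTranspose_apply, submatrix_apply, id]
    rw [this]
    simp [one_apply, Subtype.val_inj]
  · ext i j
    rw [h3]
    simp only [mul_apply, conjTranspose_apply, submatrix_apply, id, diagonal_apply, mul_ite,
      mul_zero, Finset.sum_ite_eq', Finset.mem_univ, if_true]
    rw [Equiv.sum_comp e (fun k : S => U i k * star (U j k)),
      ← Finset.sum_subtype (Finset.univ.filter fun k => a k = 1) (by simp)
        (fun k => U i k * star (U j k)), Finset.sum_filter]
    refine Finset.sum_congr rfl fun k _ => ?_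
    rcases ha k with h | h <;> simp [h]

end SpectralProjections

/-! ### Positivity and completely positive maps in Kraus form -/

section CompletelyPositiveMaps

open Matrix

section Positivity

variable {κ : Type*}

theorem isHermitian_real_smul {M : Matrix κ κ ℂ} (hM : M.IsHermitian) (r : ℝ) :
    ((r : ℂ) • M).IsHermitian := by
  rw [IsHermitian, conjTranspose_smul, hM.eq]
  simp

theorem posSemidef_real_smul {M : Matrix κ κ ℂ} (hM : M.PosSemidef) {r : ℝ} (hr : 0 ≤ r) :
    ((r : ℂ) • M).PosSemidef :=
  hM.smul (Complex.zero_le_real.mpr hr)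

variable [Fintype κ]

/-- A Hermitian matrix is positive semidefinite once the real parts of its quadratic form are
nonnegative. -/
theorem posSemidef_of_re_nonneg {M : Matrix κ κ ℂ} (hM : M.IsHermitian)
    (h : ∀ v : κ → ℂ, 0 ≤ (star v ⬝ᵥ M *ᵥ v).re) : M.PosSemidef := by
  refine PosSemidef.of_dotProduct_mulVec_nonneg hM fun v => ?_
  rw [Complex.nonneg_iff]
  exact ⟨h v, (hM.im_star_dotProduct_mulVec_self v).symm⟩

theorem re_nonneg_of_posSemidef {M : Matrix κ κ ℂ} (hM : M.PosSemidef) (v : κ → ℂ) :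
    0 ≤ (star v ⬝ᵥ M *ᵥ v).re :=
  (Complex.nonneg_iff.mp (hM.dotProduct_mulVec_nonneg v)).1

theorem star_dotProduct_self_pos {v : κ → ℂ} (hv : v ≠ 0) : 0 < (star v ⬝ᵥ v).re := by
  have := dotProduct_star_self_pos_iff (v := v) |>.mpr hv
  exact (Complex.pos_iff.mp this).1

variable [DecidableEq κ]

theorem posSemidef_of_forall_add_smul {M : Matrix κ κ ℂ}
    (h : ∀ ε : ℝ, 0 < ε → (M + (ε : ℂ) • 1).PosSemidef) : M.PosSemidef := by
  have hH : M.IsHermitian := by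
    have h1 := (h 1 one_pos).isHermitian.sub
      (isHermitian_real_smul (isHermitian_one : (1 : Matrix κ κ ℂ).IsHermitian) 1)
    simpa using h1
  refine posSemidef_of_re_nonneg hH fun v => ?_
  refine le_of_forall_pos_le_add fun δ hδ => ?_
  have hc : 0 ≤ (star v ⬝ᵥ v).re := by
    simpa using re_nonneg_of_posSemidef (PosSemidef.one : (1 : Matrix κ κ ℂ).PosSemidef) v
  -- The `+ 1` keeps the denominator positive when `v = 0`.
  have := re_nonneg_of_posSemidef (h (δ / ((star v ⬝ᵥ v).re + 1)) (by positivity)) v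
  rw [add_mulVec, smul_mulVec, one_mulVec, dotProduct_add, dotProduct_smul, smul_eq_mul,
    Complex.add_re, Complex.re_ofReal_mul] at this
  have h2 : δ / ((star v ⬝ᵥ v).re + 1) * (star v ⬝ᵥ v).re ≤ δ := by
    rw [div_mul_eq_mul_div, div_le_iff₀ (by positivity)]
    nlinarith
  linarith

/-- A Hermitian matrix that is nonnegative on the kernel of `W ⪰ 0` becomes nonnegative after
adding a small multiple of the identity and a large multiple of `W`. -/
theorem exists_add_smul_posSemidef {M W : Matrix κ κ ℂ} (hM : M.IsHermitian) (hW : W.PosSemidef)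
    (h : ∀ v, W *ᵥ v = 0 → 0 ≤ (star v ⬝ᵥ M *ᵥ v).re) {ε : ℝ} (hε : 0 < ε) :
    ∃ C : ℝ, 0 ≤ C ∧ (M + (ε : ℂ) • 1 + (C : ℂ) • W).PosSemidef := by
  let f : ℝ → (κ → ℂ) → ℝ := fun C v => (star v ⬝ᵥ (M + (ε : ℂ) • 1 + (C : ℂ) • W) *ᵥ v).re
  have hf : ∀ C v, f C v = (star v ⬝ᵥ M *ᵥ v).re + ε * (star v ⬝ᵥ v).re
      + C * (star v ⬝ᵥ W *ᵥ v).re := by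
    intro C v
    simp only [f, add_mulVec, smul_mulVec, one_mulVec, dotProduct_add, dotProduct_smul,
      smul_eq_mul, Complex.add_re, Complex.re_ofReal_mul]
  have hcont : ∀ C, Continuous (f C) := by
    intro C
    simp only [f, dotProduct, mulVec, Pi.star_apply]
    fun_prop
  -- The open sets where the form is positive increase with `k`, as `W ⪰ 0`, and cover the unit
  -- sphere: `k = 0` serves where the form of `W` vanishes, thanks to `ε`, and a large `k`
  -- elsewhere. By compactness one `k` serves everywhere.
  obtain ⟨N, hN⟩ := (isCompact_sphere (0 : κ → ℂ) 1).elim_directed_cover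
    (fun k : ℕ => {v | 0 < f k v}) (fun k => isOpen_lt continuous_const (hcont k))
    (by
      intro v hv
      have hv0 : v ≠ 0 := by
        rintro rfl
        simp at hv
      have h1 := mul_pos hε (star_dotProduct_self_pos hv0)
      have hWv := re_nonneg_of_posSemidef hW v
      rw [Set.mem_iUnion]
      rcases hWv.eq_or_lt with h0 | h0
      · refine ⟨0, ?_⟩
        have hk : W *ᵥ v = 0 := by
          rw [← hW.dotProduct_mulVec_zero_iff]
          refine Complex.ext h0.symm ?_
          exact hW.isHermitian.im_star_dotProduct_mulVec_self v
        have := h v hk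
        rw [Set.mem_ofPred_eq, hf, ← h0]
        simp only [mul_zero]
        linarith
      · obtain ⟨k, hk⟩ := exists_nat_gt (-(star v ⬝ᵥ M *ᵥ v).re / (star v ⬝ᵥ W *ᵥ v).re)
        refine ⟨k, ?_⟩
        rw [div_lt_iff₀ h0] at hk
        rw [Set.mem_ofPred_eq, hf]
        linarith)
    (by
      refine directed_of_isDirected_le fun i j hij v hv => ?_
      rw [Set.mem_ofPred_eq, hf] at hv ⊢
      have : (i : ℝ) ≤ j := by exact_mod_cast hij
      have := mul_le_mul_of_nonneg_right this (re_nonneg_of_posSemidef hW v)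
      linarith)
  refine ⟨N, N.cast_nonneg, posSemidef_of_re_nonneg ?_ fun v => ?_⟩
  · exact (hM.add (isHermitian_real_smul isHermitian_one ε)).add
      (isHermitian_real_smul hW.isHermitian N)
  · change 0 ≤ f N v
    by_cases hv : v = 0
    · simp [hf, hv]
    · have hn : ‖v‖ ≠ 0 := norm_ne_zero_iff.mpr hv
      have h1 : 0 < f N (((‖v‖⁻¹ : ℝ) : ℂ) • v) := by
        refine hN ?_
        rw [mem_sphere_zero_iff_norm, norm_smul]
        simp [hn]
      have h2 : f N (((‖v‖⁻¹ : ℝ) : ℂ) • v) = (‖v‖⁻¹ * ‖v‖⁻¹) * f N v := by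
        simp only [f, mulVec_smul, dotProduct_smul, star_smul, smul_dotProduct, smul_eq_mul]
        rw [← mul_assoc, RCLike.star_def, Complex.conj_ofReal, ← Complex.ofReal_mul,
          Complex.re_ofReal_mul]
      rw [h2] at h1
      have : 0 < ‖v‖⁻¹ * ‖v‖⁻¹ := by positivity
      exact (pos_of_mul_pos_right h1 this.le).le

/-- No eigenvalue of a positive matrix exceeds their sum. This turns a small trace into a small
upper bound in the matrix order. -/
theorem posSemidef_trace_smul_sub {d : ℕ} {M : Matrix (Fin d) (Fin d) ℂ} (hM : M.PosSemidef) :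
    (((M.trace.re : ℝ) : ℂ) • 1 - M).PosSemidef := by
  obtain ⟨U, a, h1, h2, h3⟩ := exists_unitary_diagonal hM.isHermitian
  have ha : ∀ i, 0 ≤ a i := by
    have h4 : Uᴴ * M * U = diagonal (fun i => (a i : ℂ)) := by
      rw [h3]
      calc _ = (Uᴴ * U) * diagonal (fun i => (a i : ℂ)) * (Uᴴ * U) := by simp only [mul_assoc]
        _ = _ := by rw [h1]; simp
    have h5 := hM.conjTranspose_mul_mul_same U
    rw [h4, posSemidef_diagonal_iff] at h5
    exact fun i => by exact_mod_cast h5 i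
  have ht : M.trace.re = ∑ i, a i := by
    rw [h3, trace_mul_comm, ← mul_assoc, h1, one_mul, trace_diagonal]
    simp
  have : ((M.trace.re : ℝ) : ℂ) • 1 - M
      = U * diagonal (fun i => ((∑ j, a j - a i : ℝ) : ℂ)) * Uᴴ := by
    have hd : diagonal (fun i => ((∑ j, a j - a i : ℝ) : ℂ))
        = ((∑ j, a j : ℝ) : ℂ) • 1 - diagonal (fun i => (a i : ℂ)) := by
      rw [← diagonal_one, ← diagonal_smul, diagonal_sub]
      congr 1
      ext i
      simp
    rw [hd, ht, Matrix.mul_sub, Matrix.sub_mul, ← h3, Matrix.mul_smul, mul_one, Matrix.smul_mul, h2]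
  rw [this]
  refine PosSemidef.mul_mul_conjTranspose_same ?_ U
  rw [posSemidef_diagonal_iff]
  intro i
  rw [Complex.zero_le_real, sub_nonneg]
  exact Finset.single_le_sum (fun j _ => ha j) (Finset.mem_univ i)

end Positivity

section Kraus

variable {ι κ : Type*} [Fintype ι] [Fintype κ] [DecidableEq κ]

/-- The completely positive map `x ↦ ∑ᵢ Vᵢ^* x Vᵢ`. -/
def krausMap (V : ι → Matrix κ κ ℂ) : Matrix κ κ ℂ →ₗ[ℂ] Matrix κ κ ℂ where
  toFun x := ∑ i, (V i)ᴴ * x * V i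
  map_add' x y := by simp only [mul_add, add_mul, Finset.sum_add_distrib]
  map_smul' c x := by simp only [Matrix.mul_smul, Matrix.smul_mul, Finset.smul_sum, RingHom.id_apply]

theorem krausMap_apply (V : ι → Matrix κ κ ℂ) (x : Matrix κ κ ℂ) :
    krausMap V x = ∑ i, (V i)ᴴ * x * V i := rfl

theorem krausMap_posSemidef (V : ι → Matrix κ κ ℂ) {x : Matrix κ κ ℂ} (hx : x.PosSemidef) :
    (krausMap V x).PosSemidef :=
  posSemidef_sum _ fun i _ => hx.conjTranspose_mul_mul_same (V i)

theorem krausMap_conjTranspose (V : ι → Matrix κ κ ℂ) (x : Matrix κ κ ℂ) :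
    krausMap V xᴴ = (krausMap V x)ᴴ := by
  simp only [krausMap_apply, conjTranspose_sum, conjTranspose_mul, conjTranspose_conjTranspose,
    mul_assoc]

/-- Tensoring the Kraus operators with the identity gives the ampliation of the map; being again in
Kraus form, it preserves positivity of pencils. -/
theorem krausMap_kronecker {ν : Type*} [Fintype ν] [DecidableEq ν] (V : ι → Matrix κ κ ℂ)
    (x : Matrix κ κ ℂ) (y : Matrix ν ν ℂ) :
    krausMap (fun i => V i ⊗ₖ (1 : Matrix ν ν ℂ)) (x ⊗ₖ y) = krausMap V x ⊗ₖ y := by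
  ext p q
  simp only [krausMap_apply, conjTranspose_kronecker, conjTranspose_one, ← mul_kronecker_mul,
    one_mul, mul_one]
  simp only [Matrix.sum_apply, kroneckerMap_apply, Finset.sum_mul]

theorem pow_krausMap_posSemidef (V : ι → Matrix κ κ ℂ) {x : Matrix κ κ ℂ} (hx : x.PosSemidef)
    (k : ℕ) : ((krausMap V ^ k) x).PosSemidef := by
  induction k with
  | zero => simpa using hx
  | succ k ih =>
    rw [pow_succ', Module.End.mul_apply]
    exact krausMap_posSemidef V ih

theorem pow_krausMap_one {V : ι → Matrix κ κ ℂ} (hV : krausMap V 1 = 1) (k : ℕ) :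
    (krausMap V ^ k) 1 = 1 := by
  induction k with
  | zero => simp
  | succ k ih => rw [pow_succ', Module.End.mul_apply, ih, hV]

/-- The defect in the Schwarz inequality of a unital completely positive map. -/
theorem krausMap_schwarz_defect {V : ι → Matrix κ κ ℂ} (hV : krausMap V 1 = 1)
    (x : Matrix κ κ ℂ) :
    ∑ i, (x * V i - V i * krausMap V x)ᴴ * (x * V i - V i * krausMap V x)
      = krausMap V (xᴴ * x) - (krausMap V x)ᴴ * krausMap V x := by
  set y := krausMap V x with hy
  have e1 : ∑ i, (V i)ᴴ * V i = 1 := by simpa [krausMap_apply] using hV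
  have e2 : ∑ i, (V i)ᴴ * x * V i = y := rfl
  have e3 : ∑ i, (V i)ᴴ * xᴴ * V i = yᴴ := krausMap_conjTranspose V x
  have : ∀ i, (x * V i - V i * y)ᴴ * (x * V i - V i * y) = (V i)ᴴ * (xᴴ * x) * V i
      - ((V i)ᴴ * xᴴ * V i) * y - yᴴ * ((V i)ᴴ * x * V i) + yᴴ * ((V i)ᴴ * V i) * y := by
    intro i
    simp only [conjTranspose_sub, conjTranspose_mul]
    noncomm_ring
  simp only [this, Finset.sum_add_distrib, Finset.sum_sub_distrib, ← Finset.sum_mul,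
    ← Finset.mul_sum, e1, e2, e3, krausMap_apply]
  noncomm_ring

/-- A bounded increment of a unital completely positive map decays along a subsequence. -/
theorem exists_trace_pow_krausMap_lt {d : ℕ} {V : ι → Matrix (Fin d) (Fin d) ℂ}
    (hV : krausMap V 1 = 1) {h : Matrix (Fin d) (Fin d) ℂ} (hh : h.PosSemidef)
    {δ : ℝ} (hδ : 0 < δ) :
    ∃ k, ((krausMap V ^ k) (krausMap V h - h)).trace.re < δ := by
  by_contra hcon
  push Not at hcon
  set Φ := krausMap V
  have tel : ∀ N : ℕ, ∑ k ∈ Finset.range N, (Φ ^ k) (Φ h - h) = (Φ ^ N) h - h := by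
    intro N
    induction N with
    | zero => simp
    | succ N ih =>
      rw [Finset.sum_range_succ, ih, map_sub, ← Module.End.mul_apply, ← pow_succ]
      abel
  -- The increments telescope to `Φ^N(h) - h`, whose trace is bounded uniformly in `N` because `h ⪯
  -- tr(h) • 1` and `Φ^N(1) = 1`.
  have bound : ∀ N : ℕ, N * δ ≤ h.trace.re * d := by
    intro N
    have h1 : (N : ℝ) * δ ≤ ((Φ ^ N) h - h).trace.re := by
      rw [← tel, trace_sum, Complex.re_sum]
      calc (N : ℝ) * δ = ∑ k ∈ Finset.range N, δ := by simp
        _ ≤ _ := Finset.sum_le_sum fun k _ => hcon k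
    have h2 := (pow_krausMap_posSemidef V (posSemidef_trace_smul_sub hh) N).trace_nonneg
    rw [map_sub, map_smul, pow_krausMap_one hV, trace_sub, trace_smul, trace_one] at h2
    have h3 := (Complex.nonneg_iff.mp h2).1
    have h4 := (Complex.nonneg_iff.mp hh.trace_nonneg).1
    simp only [Fintype.card_fin, smul_eq_mul, Complex.sub_re, Complex.mul_re, Complex.ofReal_re,
      Complex.natCast_re, Complex.ofReal_im, zero_mul, sub_zero] at h3
    rw [trace_sub, Complex.sub_re] at h1
    have h5 : ((Φ ^ N) h).trace.re ≤ h.trace.re * d := by linarith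
    linarith
  obtain ⟨N, hN⟩ := exists_nat_gt (h.trace.re * d / δ)
  rw [div_lt_iff₀ hδ] at hN
  linarith [bound N]

end Kraus

end CompletelyPositiveMaps

/-! ### Pencils, minimality and fixed points of completely positive maps -/

section Pencils

open Matrix

variable {g d d' n : ℕ}

theorem mem_freeSpectrahedron {A : Fin g → Matrix (Fin d) (Fin d) ℂ}
    {X : Fin g → Matrix (Fin n) (Fin n) ℂ} :
    X ∈ freeSpectrahedron A n ↔ (pencil A X).PosSemidef := Iff.rfl

theorem pencil_isHermitian (A : Fin g → Matrix (Fin d) (Fin d) ℂ)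
    (X : Fin g → Matrix (Fin n) (Fin n) ℂ) : (pencil A X).IsHermitian := by
  simp only [pencil, IsHermitian, conjTranspose_sub, conjTranspose_one, conjTranspose_conjTranspose]
  abel

theorem linPart_smul_comm (c : Fin g → ℂ) (A : Fin g → Matrix (Fin d) (Fin d) ℂ)
    (X : Fin g → Matrix (Fin n) (Fin n) ℂ) :
    linPart A (fun s => c s • X s) = linPart (fun s => c s • A s) X := by
  simp only [linPart, kronecker_smul, smul_kronecker]

theorem pencil_smul_comm (c : Fin g → ℂ) (A : Fin g → Matrix (Fin d) (Fin d) ℂ)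
    (X : Fin g → Matrix (Fin n) (Fin n) ℂ) :
    pencil A (fun s => c s • X s) = pencil (fun s => c s • A s) X := by
  simp only [pencil, linPart_smul_comm]

theorem pencil_compress {A : Fin g → Matrix (Fin d) (Fin d) ℂ} {J : Matrix (Fin d) (Fin d') ℂ}
    (hJ : Jᴴ * J = 1) (X : Fin g → Matrix (Fin n) (Fin n) ℂ) :
    pencil (fun s => Jᴴ * A s * J) X
      = (J ⊗ₖ (1 : Matrix (Fin n) (Fin n) ℂ))ᴴ * pencil A X * (J ⊗ₖ (1 : Matrix (Fin n) (Fin n) ℂ)) := by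
  have h1 : linPart (fun s => Jᴴ * A s * J) X
      = (J ⊗ₖ (1 : Matrix (Fin n) (Fin n) ℂ))ᴴ * linPart A X * (J ⊗ₖ (1 : Matrix (Fin n) (Fin n) ℂ)) := by
    simp only [linPart, Matrix.mul_sum, Matrix.sum_mul, conjTranspose_kronecker, conjTranspose_one,
      ← mul_kronecker_mul, one_mul, mul_one]
  have h2 : (J ⊗ₖ (1 : Matrix (Fin n) (Fin n) ℂ))ᴴ * (J ⊗ₖ (1 : Matrix (Fin n) (Fin n) ℂ)) = 1 := by
    rw [conjTranspose_kronecker, conjTranspose_one, ← mul_kronecker_mul, hJ, one_mul,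
      one_kronecker_one]
  rw [pencil, h1, pencil]
  simp only [Matrix.mul_sub, Matrix.sub_mul, h2, conjTranspose_mul,
    conjTranspose_conjTranspose, Matrix.mul_assoc, Matrix.mul_one]

/-- A unital completely positive map scaling the coefficients acts on the pencil. -/
theorem krausMap_pencil {ι : Type*} [Fintype ι] {V : ι → Matrix (Fin d) (Fin d) ℂ}
    {A : Fin g → Matrix (Fin d) (Fin d) ℂ} {γ : Fin g → ℂ} (hV : krausMap V 1 = 1)
    (hA : ∀ s, krausMap V (A s) = γ s • A s) (X : Fin g → Matrix (Fin n) (Fin n) ℂ) :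
    krausMap (fun i => V i ⊗ₖ (1 : Matrix (Fin n) (Fin n) ℂ)) (pencil A X)
      = pencil A (fun s => γ s • X s) := by
  have h1 : krausMap (fun i => V i ⊗ₖ (1 : Matrix (Fin n) (Fin n) ℂ)) (linPart A X)
      = linPart A (fun s => γ s • X s) := by
    simp only [linPart, map_sum, krausMap_kronecker, hA, kronecker_smul, smul_kronecker]
  have h2 : krausMap (fun i => V i ⊗ₖ (1 : Matrix (Fin n) (Fin n) ℂ)) 1 = 1 := by
    rw [← one_kronecker_one, krausMap_kronecker, hV]
  rw [pencil, map_sub, map_sub, krausMap_conjTranspose, h1, h2, pencil]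

/-- Dilating the variable trades a bound `pencil ⪰ -ε` for membership of a rescaled point, to which
torus invariance applies. -/
theorem smul_pencil_inv_smul (A : Fin g → Matrix (Fin d) (Fin d) ℂ)
    (X : Fin g → Matrix (Fin n) (Fin n) ℂ) {r : ℝ} (hr : r ≠ 0) :
    (r : ℂ) • pencil A (fun s => ((r⁻¹ : ℝ) : ℂ) • X s) = pencil A X + ((r - 1 : ℝ) : ℂ) • 1 := by
  have h1 : linPart A (fun s => ((r⁻¹ : ℝ) : ℂ) • X s) = ((r⁻¹ : ℝ) : ℂ) • linPart A X := by
    simp only [linPart, kronecker_smul, Finset.smul_sum]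
  have hc : (r : ℂ) * ((r⁻¹ : ℝ) : ℂ) = 1 := by
    rw [← Complex.ofReal_mul, mul_inv_cancel₀ hr, Complex.ofReal_one]
  rw [pencil, pencil, h1, conjTranspose_smul, RCLike.star_def, Complex.conj_ofReal, smul_sub,
    smul_sub, smul_smul, smul_smul, hc, one_smul, one_smul, Complex.ofReal_sub, sub_smul,
    Complex.ofReal_one, one_smul]
  abel

/-- In the Reinhardt case a lower bound of the pencil is invariant under the torus. -/
theorem IsReinhardt.pencil_add_smul {A : Fin g → Matrix (Fin d) (Fin d) ℂ}
    (hR : IsReinhardt (freeSpectrahedron A)) {X : Fin g → Matrix (Fin n) (Fin n) ℂ} {ε : ℝ}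
    (hε : 0 ≤ ε) (h : (pencil A X + (ε : ℂ) • 1).PosSemidef) (γ : Fin g → Circle) :
    (pencil A (fun s => (γ s : ℂ) • X s) + (ε : ℂ) • 1).PosSemidef := by
  have hr : (1 + ε) ≠ 0 := by positivity
  have e := fun X : Fin g → Matrix (Fin n) (Fin n) ℂ => smul_pencil_inv_smul A X hr
  simp only [add_sub_cancel_left] at e
  rw [← e] at h ⊢
  have h' := posSemidef_real_smul h (r := (1 + ε)⁻¹) (by positivity)
  rw [smul_smul, ← Complex.ofReal_mul, inv_mul_cancel₀ hr, Complex.ofReal_one, one_smul] at h'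
  have h2 := hR n _ h' γ
  refine posSemidef_real_smul ?_ (by positivity)
  rw [mem_freeSpectrahedron] at h2
  convert h2 using 3
  rw [smul_comm]

/-- A minimal defining tuple cannot be replaced by a compression to a proper subspace. -/
theorem IsMinimalDefiningTuple.not_compress {A : Fin g → Matrix (Fin d) (Fin d) ℂ}
    (hmin : IsMinimalDefiningTuple A (freeSpectrahedron A)) {J : Matrix (Fin d) (Fin d') ℂ}
    (hd : d' < d) (hJ : Jᴴ * J = 1)
    (h : ∀ (n : ℕ) (X : Fin g → Matrix (Fin n) (Fin n) ℂ),
      (pencil (fun s => Jᴴ * A s * J) X).PosSemidef → (pencil A X).PosSemidef) : False := by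
  refine absurd (hmin.2 d' (fun s => Jᴴ * A s * J) ?_) (not_le.mpr hd)
  funext n
  ext X
  refine ⟨fun hX => ?_, fun hX => h n X hX⟩
  rw [mem_freeSpectrahedron] at hX ⊢
  rw [pencil_compress hJ]
  exact hX.conjTranspose_mul_mul_same _

theorem kronecker_one_mulVec_apply (M : Matrix (Fin d) (Fin d) ℂ) (v : Fin d × Fin n → ℂ)
    (a : Fin d) (j : Fin n) :
    ((M ⊗ₖ (1 : Matrix (Fin n) (Fin n) ℂ)) *ᵥ v) (a, j) = (M *ᵥ fun b => v (b, j)) a := by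
  simp only [mulVec, dotProduct, kroneckerMap_apply, Fintype.sum_prod_type, one_apply, mul_ite,
    mul_one, mul_zero, ite_mul, zero_mul, Finset.sum_ite_eq, Finset.mem_univ, if_true]

/-- For a minimal defining tuple of a Reinhardt free spectrahedron, every positive matrix that is
subharmonic for a unital completely positive map scaling the tuple by unimodular factors is
harmonic. -/
theorem krausMap_eq_of_le {ι : Type*} [Fintype ι] {A : Fin g → Matrix (Fin d) (Fin d) ℂ}
    (hmin : IsMinimalDefiningTuple A (freeSpectrahedron A))
    (hR : IsReinhardt (freeSpectrahedron A)) {V : ι → Matrix (Fin d) (Fin d) ℂ}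
    {γ : Fin g → Circle} (hV : krausMap V 1 = 1)
    (hA : ∀ s, krausMap V (A s) = (γ s : ℂ) • A s) {h : Matrix (Fin d) (Fin d) ℂ}
    (hh : h.PosSemidef) (hle : (krausMap V h - h).PosSemidef) : krausMap V h = h := by
  by_contra hne
  set Δ := krausMap V h - h with hΔ
  -- `Q` projects onto the kernel of `Δ`, a proper subspace; the compression of `A` to it is shown
  -- to define the same free spectrahedron.
  obtain ⟨Q, hQ, hQ2, hΔQ, hker, -⟩ := exists_spectral_projection hle.isHermitian 0
  have hQ1 : Q ≠ 1 := by
    rintro rfl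
    simp only [mul_one, Complex.ofReal_zero, zero_smul] at hΔQ
    exact hne (sub_eq_zero.mp hΔQ)
  obtain ⟨d', J, hd, hJ, hJQ⟩ := exists_isometry_of_projection hQ hQ2 hQ1
  refine hmin.not_compress hd hJ fun n X hX => ?_
  refine posSemidef_of_forall_add_smul fun ε hε => ?_
  have hkerL : ∀ v, (Δ ⊗ₖ (1 : Matrix (Fin n) (Fin n) ℂ)) *ᵥ v = 0 →
      0 ≤ (star v ⬝ᵥ pencil A X *ᵥ v).re := by
    intro v hv
    have hv' : (Q ⊗ₖ (1 : Matrix (Fin n) (Fin n) ℂ)) *ᵥ v = v := by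
      ext ⟨a, j⟩
      rw [kronecker_one_mulVec_apply, hker]
      ext b
      have := congrFun hv (b, j)
      rw [kronecker_one_mulVec_apply] at this
      simpa using this
    rw [pencil_compress hJ] at hX
    have h1 := re_nonneg_of_posSemidef hX ((J ⊗ₖ (1 : Matrix (Fin n) (Fin n) ℂ))ᴴ *ᵥ v)
    have h2 : (J ⊗ₖ (1 : Matrix (Fin n) (Fin n) ℂ)) *ᵥ
        ((J ⊗ₖ (1 : Matrix (Fin n) (Fin n) ℂ))ᴴ *ᵥ v) = v := by
      rw [mulVec_mulVec, conjTranspose_kronecker, conjTranspose_one, ← mul_kronecker_mul, hJQ,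
        one_mul, hv']
    rwa [← mulVec_mulVec, h2, ← mulVec_mulVec, dotProduct_mulVec, ← star_mulVec, h2] at h1
  obtain ⟨C, hC, hpos⟩ := exists_add_smul_posSemidef (pencil_isHermitian A X)
    (hle.kronecker (PosSemidef.one : (1 : Matrix (Fin n) (Fin n) ℂ).PosSemidef)) hkerL
    (half_pos hε)
  -- Each application of the ampliated map rotates `X` once more by `γ`, leaves the `ε` term alone
  -- and replaces `Δ` by its next iterate.
  have hiter : ∀ k : ℕ, (pencil A (fun s => ((γ s ^ k : Circle) : ℂ) • X s)
      + ((ε / 2 : ℝ) : ℂ) • 1 + (C : ℂ) • ((krausMap V ^ k) Δ ⊗ₖ 1)).PosSemidef := by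
    intro k
    induction k with
    | zero => simpa using hpos
    | succ k ih =>
      have := krausMap_posSemidef (fun i => V i ⊗ₖ (1 : Matrix (Fin n) (Fin n) ℂ)) ih
      rw [map_add, map_add, map_smul, map_smul, krausMap_pencil hV hA, krausMap_kronecker,
        ← one_kronecker_one, krausMap_kronecker, hV, one_kronecker_one] at this
      simp only [smul_smul] at this
      simpa only [pow_succ', Module.End.mul_apply, Circle.coe_mul] using this
  -- The threshold makes `C` times the trace at most `ε / 2`; `C + 1` is used because `C` may be
  -- zero.
  obtain ⟨k, hk⟩ := exists_trace_pow_krausMap_lt hV hh (δ := ε / (2 * (C + 1))) (by positivity)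
  rw [← hΔ] at hk
  set Y := (krausMap V ^ k) Δ with hY
  have hYpos : Y.PosSemidef := pow_krausMap_posSemidef V hle k
  have htr := (Complex.nonneg_iff.mp hYpos.trace_nonneg).1
  have hCt : C * Y.trace.re ≤ ε / 2 := by
    have h1 : C * Y.trace.re ≤ (C + 1) * (ε / (2 * (C + 1))) :=
      mul_le_mul (by linarith) hk.le htr (by linarith)
    have h2 : (C + 1) * (ε / (2 * (C + 1))) = ε / 2 := by field_simp
    linarith
  have hdom : (pencil A (fun s => ((γ s ^ k : Circle) : ℂ) • X s) + (ε : ℂ) • 1).PosSemidef := by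
    have h1 := posSemidef_real_smul ((posSemidef_trace_smul_sub hYpos).kronecker
      (PosSemidef.one : (1 : Matrix (Fin n) (Fin n) ℂ).PosSemidef)) hC
    have h2 := posSemidef_real_smul
      (PosSemidef.one : (1 : Matrix (Fin d × Fin n) (Fin d × Fin n) ℂ).PosSemidef)
      (sub_nonneg.mpr hCt)
    convert ((hiter k).add h1).add h2 using 1
    have hsplit : (((Y.trace.re : ℝ) : ℂ) • 1 - Y) ⊗ₖ (1 : Matrix (Fin n) (Fin n) ℂ)
        = ((Y.trace.re : ℝ) : ℂ) • 1 - Y ⊗ₖ 1 := eq_sub_of_add_eq (by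
      rw [← add_kronecker, sub_add_cancel, smul_kronecker, one_kronecker_one])
    rw [hsplit]
    simp only [smul_sub, smul_smul, Complex.ofReal_sub, Complex.ofReal_mul, sub_smul,
      Complex.ofReal_div, Complex.ofReal_ofNat]
    have : (ε : ℂ) • (1 : Matrix (Fin d × Fin n) (Fin d × Fin n) ℂ)
      = ((ε : ℂ) / 2) • 1 + ((ε : ℂ) / 2) • 1 := by rw [← add_smul, add_halves]
    rw [this]
    abel
  -- The accumulated rotation by `γ^k` is undone by torus invariance.
  have := hR.pencil_add_smul hε.le hdom (fun s => (γ s ^ k)⁻¹)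
  simpa [smul_smul, ← Circle.coe_mul] using this

/-- The Kraus operators intertwine the scaled tuple with the tuple. -/
theorem kraus_intertwines {ι : Type*} [Fintype ι] {A : Fin g → Matrix (Fin d) (Fin d) ℂ}
    (hmin : IsMinimalDefiningTuple A (freeSpectrahedron A))
    (hR : IsReinhardt (freeSpectrahedron A)) {V : ι → Matrix (Fin d) (Fin d) ℂ}
    {γ : Fin g → Circle} (hV : krausMap V 1 = 1)
    (hA : ∀ s, krausMap V (A s) = (γ s : ℂ) • A s) (s : Fin g) (i : ι) :
    A s * V i = (γ s : ℂ) • (V i * A s) ∧ (A s)ᴴ * V i = star (γ s : ℂ) • (V i * (A s)ᴴ) := by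
  -- For `Φ(x) = c • x` with `c` unimodular, the Schwarz inequality reads `xᴴ * x ⪯ Φ(xᴴ * x)`.
  -- Equality is then forced, so the defect, a sum of positive terms, vanishes termwise.
  have key : ∀ (x : Matrix (Fin d) (Fin d) ℂ) (c : ℂ), krausMap V x = c • x → star c * c = 1 →
      ∀ i, x * V i = c • (V i * x) := by
    intro x c hx hc i
    have hd := krausMap_schwarz_defect hV x
    have e : (krausMap V x)ᴴ * krausMap V x = xᴴ * x := by
      rw [hx, conjTranspose_smul, Matrix.smul_mul, Matrix.mul_smul, smul_smul, hc, one_smul]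
    rw [e] at hd
    have hpos : ∀ i ∈ Finset.univ, ((x * V i - V i * krausMap V x)ᴴ *
        (x * V i - V i * krausMap V x)).PosSemidef :=
      fun i _ => posSemidef_conjTranspose_mul_self _
    have heq := krausMap_eq_of_le hmin hR hV hA (posSemidef_conjTranspose_mul_self x)
      (hd ▸ posSemidef_sum _ hpos)
    rw [heq, sub_self] at hd
    have ht := congrArg trace hd
    rw [trace_sum, trace_zero, Finset.sum_eq_zero_iff_of_nonneg
      (fun i hi => (hpos i hi).trace_nonneg)] at ht
    have := trace_conjTranspose_mul_self_eq_zero_iff.mp (ht i (Finset.mem_univ i))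
    rw [sub_eq_zero, hx, Matrix.mul_smul] at this
    exact this
  have hu : star (γ s : ℂ) * (γ s : ℂ) = 1 := by
    rw [RCLike.star_def, ← Complex.normSq_eq_conj_mul_self, Circle.normSq_coe, Complex.ofReal_one]
  refine ⟨key (A s) _ (hA s) hu i, key (A s)ᴴ _ ?_ ?_ i⟩
  · rw [krausMap_conjTranspose, hA, conjTranspose_smul]
  · rw [star_star, mul_comm, hu]

end Pencils

/-! ### The commutant and the unitary intertwiner -/

section Intertwiners

open Matrix

variable {g d n : ℕ}

/-- A nonzero positive semidefinite matrix has a nonzero spectral projection for a positive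
eigenvalue. -/
theorem exists_pos_spectral_projection {H : Matrix (Fin d) (Fin d) ℂ} (hH : H.PosSemidef)
    (hne : H ≠ 0) :
    ∃ (r : ℝ) (P : Matrix (Fin d) (Fin d) ℂ), 0 < r ∧ P ≠ 0 ∧ Pᴴ = P ∧ P * P = P ∧
      H * P = (r : ℂ) • P ∧ ∀ B, B * H = H * B → B * P = P * B := by
  obtain ⟨U, a, h1, h2, h3⟩ := exists_unitary_diagonal hH.isHermitian
  obtain ⟨i, hi⟩ : ∃ i, a i ≠ 0 := by
    by_contra hcon
    push Not at hcon
    apply hne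
    rw [h3]
    simp [hcon]
  obtain ⟨P, hP1, hP2, hP3, hP4, hP5⟩ := exists_spectral_projection hH.isHermitian (a i)
  set v : Fin d → ℂ := U *ᵥ Pi.single i 1 with hv
  have hUv : Uᴴ *ᵥ v = Pi.single i 1 := by rw [hv, mulVec_mulVec, h1, one_mulVec]
  have hv0 : v ≠ 0 := by
    intro h0
    have := congrFun hUv i
    simp [h0] at this
  have hHv : H *ᵥ v = (a i : ℂ) • v := by
    rw [h3, ← mulVec_mulVec, ← mulVec_mulVec, hUv, diagonal_mulVec_single, mul_one, hv, ← mulVec_smul,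
      ← Pi.single_smul, smul_eq_mul, mul_one]
  refine ⟨a i, P, ?_, ?_, hP1, hP2, hP3, hP5⟩
  · refine lt_of_le_of_ne ?_ (Ne.symm hi)
    have := re_nonneg_of_posSemidef hH v
    rw [hHv, dotProduct_smul, smul_eq_mul, Complex.re_ofReal_mul] at this
    exact nonneg_of_mul_nonneg_left this (star_dotProduct_self_pos hv0)
  · rintro rfl
    have := hP4 v hHv
    rw [zero_mulVec] at this
    exact hv0 this.symm

/-- The matrix commutes with the tuple and its adjoints. -/
def InCommutant (A : Fin g → Matrix (Fin d) (Fin d) ℂ) (T : Matrix (Fin d) (Fin d) ℂ) : Prop :=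
  ∀ s, A s * T = T * A s ∧ (A s)ᴴ * T = T * (A s)ᴴ

namespace InCommutant

variable {A : Fin g → Matrix (Fin d) (Fin d) ℂ} {S T : Matrix (Fin d) (Fin d) ℂ}

theorem conjTranspose (hT : InCommutant A T) : InCommutant A Tᴴ := fun s =>
  ⟨by simpa using (congrArg Matrix.conjTranspose (hT s).2).symm,
    by simpa using (congrArg Matrix.conjTranspose (hT s).1).symm⟩

theorem mul (hS : InCommutant A S) (hT : InCommutant A T) : InCommutant A (S * T) := fun s =>
  ⟨by rw [← mul_assoc, (hS s).1, mul_assoc, (hT s).1, mul_assoc],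
    by rw [← mul_assoc, (hS s).2, mul_assoc, (hT s).2, mul_assoc]⟩

theorem one_sub (hT : InCommutant A T) : InCommutant A (1 - T) := fun s =>
  ⟨by rw [mul_sub, sub_mul, (hT s).1, mul_one, one_mul],
    by rw [mul_sub, sub_mul, (hT s).2, mul_one, one_mul]⟩

theorem spectral (hT : InCommutant A T) {P : Matrix (Fin d) (Fin d) ℂ}
    (hP : ∀ B, B * T = T * B → B * P = P * B) : InCommutant A P := fun s =>
  ⟨hP _ (hT s).1, hP _ (hT s).2⟩

theorem pencil_comm (hT : InCommutant A T) (X : Fin g → Matrix (Fin n) (Fin n) ℂ) :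
    pencil A X * (T ⊗ₖ (1 : Matrix (Fin n) (Fin n) ℂ))
      = (T ⊗ₖ (1 : Matrix (Fin n) (Fin n) ℂ)) * pencil A X := by
  have h1 : linPart A X * (T ⊗ₖ (1 : Matrix (Fin n) (Fin n) ℂ))
      = (T ⊗ₖ (1 : Matrix (Fin n) (Fin n) ℂ)) * linPart A X := by
    simp only [linPart, Matrix.mul_sum, Matrix.sum_mul, ← mul_kronecker_mul, one_mul, mul_one,
      fun s => (hT s).1]
  have h2 : (linPart A X)ᴴ * (T ⊗ₖ (1 : Matrix (Fin n) (Fin n) ℂ))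
      = (T ⊗ₖ (1 : Matrix (Fin n) (Fin n) ℂ)) * (linPart A X)ᴴ := by
    simp only [linPart, conjTranspose_sum, conjTranspose_kronecker, Matrix.mul_sum, Matrix.sum_mul,
      ← mul_kronecker_mul, one_mul, mul_one, fun s => (hT s).2]
  rw [pencil, sub_mul, sub_mul, mul_sub, mul_sub, h1, h2, mul_one, one_mul]

/-- The commutant of a minimal defining tuple has no nonzero element of square zero. -/
theorem eq_zero_of_mul_self (hmin : IsMinimalDefiningTuple A (freeSpectrahedron A))
    (hT : InCommutant A T) (hT2 : T * T = 0) : T = 0 := by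
  by_contra hne
  obtain ⟨r, P, hr, hP0, hP, hP2, hTP, hPc⟩ := exists_pos_spectral_projection
    (posSemidef_conjTranspose_mul_self T)
    (fun h => hne (conjTranspose_mul_self_eq_zero.mp h))
  have hPA : InCommutant A P := (hT.conjTranspose.mul hT).spectral hPc
  have hr' : (r : ℂ) ≠ 0 := by exact_mod_cast hr.ne'
  have hPT : P * Tᴴ * T = (r : ℂ) • P := by
    have := congrArg Matrix.conjTranspose hTP
    simpa [hP, mul_assoc] using this
  -- Since `P * Tᴴ * T = r • P`, the product `r • (P * T * P)` contains the factor `T * T`. So `T`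
  -- carries the range of `P` into its orthogonal complement.
  have hPTP : P * T * P = 0 := by
    have : (r : ℂ) • (P * T * P) = 0 := by
      rw [← Matrix.smul_mul, ← Matrix.smul_mul, ← hPT]
      simp only [mul_assoc]
      rw [← mul_assoc T T, hT2]
      simp
    exact (smul_eq_zero.mp this).resolve_left hr'
  have hQne : (1 - P) ≠ 1 := by
    intro h
    apply hP0
    simpa using h
  obtain ⟨d', J, hd, hJ, hJQ⟩ := exists_isometry_of_projection (Q := 1 - P)
    (by rw [conjTranspose_sub, conjTranspose_one, hP])
    (by rw [mul_sub, sub_mul, sub_mul, hP2]; simp) hQne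
  refine hmin.not_compress hd hJ fun n X hX => ?_
  rw [pencil_compress hJ] at hX
  set L := pencil A X
  set J' := J ⊗ₖ (1 : Matrix (Fin n) (Fin n) ℂ)
  set P' := P ⊗ₖ (1 : Matrix (Fin n) (Fin n) ℂ) with hP'
  set T' := T ⊗ₖ (1 : Matrix (Fin n) (Fin n) ℂ) with hT'
  have eJ : J' * J'ᴴ = 1 - P' := by
    rw [conjTranspose_kronecker, conjTranspose_one, ← mul_kronecker_mul, hJQ, one_mul]
    exact eq_sub_of_add_eq (by rw [← add_kronecker, sub_add_cancel, one_kronecker_one])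
  have eP : P' * P' = P' := by rw [← mul_kronecker_mul, hP2, one_mul]
  have ePh : P'ᴴ = P' := by rw [conjTranspose_kronecker, conjTranspose_one, hP]
  have ePTP : P' * T' * P' = 0 := by
    rw [← mul_kronecker_mul, ← mul_kronecker_mul, hPTP, zero_kronecker]
  have eTP : T'ᴴ * T' * P' = (r : ℂ) • P' := by
    rw [conjTranspose_kronecker, conjTranspose_one, ← mul_kronecker_mul, ← mul_kronecker_mul, hTP,
      smul_kronecker, one_mul, one_mul]
  have cP : L * P' = P' * L := hPA.pencil_comm X
  have cT : L * T' = T' * L := hT.pencil_comm X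
  have eQTP : (1 - P') * (T' * P') = T' * P' := by
    rw [sub_mul, one_mul, ← mul_assoc, ePTP, sub_zero]
  have h1 := hX.mul_mul_conjTranspose_same J'
  have h2 := posSemidef_real_smul (h1.conjTranspose_mul_mul_same (T' * P'))
    (r := r⁻¹) (by positivity)
  have e1 : J' * (J'ᴴ * L * J') * J'ᴴ = (1 - P') * L := by
    calc _ = (J' * J'ᴴ) * L * (J' * J'ᴴ) := by simp only [Matrix.mul_assoc]
      _ = (1 - P') * ((1 - P') * L) := by
        rw [eJ, mul_assoc (1 - P') L, mul_sub L, sub_mul 1 P' L, cP, mul_one, one_mul]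
      _ = _ := by
        rw [← mul_assoc, mul_sub (1 - P'), sub_mul 1 P' P', eP]
        simp
  -- Up to the scalar `r`, `T` embeds the range of `P` isometrically into that of `1 - P` and
  -- commutes with the pencil, so positivity of the `1 - P` part implies that of the `P` part.
  have e2 : (T' * P')ᴴ * ((1 - P') * L) * (T' * P') = (r : ℂ) • (P' * L) := by
    calc _ = (T' * P')ᴴ * ((1 - P') * (T' * P')) * L := by
          rw [mul_assoc, mul_assoc (1 - P') L, ← mul_assoc L T' P', cT, mul_assoc T' L P', cP]
          simp only [mul_assoc]
      _ = P' * (T'ᴴ * T' * P') * L := by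
          rw [eQTP, conjTranspose_mul, ePh]
          simp only [mul_assoc]
      _ = _ := by rw [eTP, Matrix.mul_smul, eP, Matrix.smul_mul]
  rw [e1] at h1 h2
  rw [e2, smul_smul, Complex.ofReal_inv, inv_mul_cancel₀ hr', one_smul] at h2
  have := h1.add h2
  rwa [← add_mul, sub_add_cancel, one_mul] at this

end InCommutant

/-- The matrix intertwines the tuple with its multiple by `γ`, together with the adjoints. -/
def Intertwines (γ : Fin g → Circle) (A : Fin g → Matrix (Fin d) (Fin d) ℂ)
    (W : Matrix (Fin d) (Fin d) ℂ) : Prop :=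
  ∀ s, A s * W = (γ s : ℂ) • (W * A s) ∧ (A s)ᴴ * W = star (γ s : ℂ) • (W * (A s)ᴴ)

namespace Intertwines

variable {A : Fin g → Matrix (Fin d) (Fin d) ℂ} {γ : Fin g → Circle}
  {V W T : Matrix (Fin d) (Fin d) ℂ}

theorem star_coe_mul_coe (z : Circle) : star (z : ℂ) * (z : ℂ) = 1 := by
  rw [RCLike.star_def, ← Complex.normSq_eq_conj_mul_self, Circle.normSq_coe, Complex.ofReal_one]

theorem zero : Intertwines γ A 0 := fun s => by simp

theorem add (hV : Intertwines γ A V) (hW : Intertwines γ A W) : Intertwines γ A (V + W) :=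
  fun s => ⟨by rw [mul_add, add_mul, smul_add, (hV s).1, (hW s).1],
    by rw [mul_add, add_mul, smul_add, (hV s).2, (hW s).2]⟩

theorem smul (hV : Intertwines γ A V) (c : ℂ) : Intertwines γ A (c • V) :=
  fun s => ⟨by rw [Matrix.mul_smul, Matrix.smul_mul, (hV s).1, smul_comm],
    by rw [Matrix.mul_smul, Matrix.smul_mul, (hV s).2, smul_comm]⟩

theorem mul_commutant (hV : Intertwines γ A V) (hT : InCommutant A T) :
    Intertwines γ A (V * T) :=
  fun s => ⟨by rw [← mul_assoc, (hV s).1, Matrix.smul_mul, mul_assoc, (hT s).1, mul_assoc],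
    by rw [← mul_assoc, (hV s).2, Matrix.smul_mul, mul_assoc, (hT s).2, mul_assoc]⟩

theorem conjTranspose_mul (hW : Intertwines γ A W) (hV : Intertwines γ A V) :
    InCommutant A (Wᴴ * V) := by
  intro s
  have h1 : A s * Wᴴ = star (γ s : ℂ) • (Wᴴ * A s) := by
    have := congrArg Matrix.conjTranspose (hW s).2
    rw [Matrix.conjTranspose_mul, conjTranspose_smul, Matrix.conjTranspose_mul,
      conjTranspose_conjTranspose, star_star] at this
    rw [this, smul_smul, star_coe_mul_coe, one_smul]
  have h2 : (A s)ᴴ * Wᴴ = (γ s : ℂ) • (Wᴴ * (A s)ᴴ) := by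
    have := congrArg Matrix.conjTranspose (hW s).1
    rw [Matrix.conjTranspose_mul, conjTranspose_smul, Matrix.conjTranspose_mul] at this
    rw [this, smul_smul, mul_comm, star_coe_mul_coe, one_smul]
  constructor
  · rw [← mul_assoc, h1, Matrix.smul_mul, mul_assoc, (hV s).1, Matrix.mul_smul, smul_smul,
      star_coe_mul_coe, one_smul, mul_assoc]
  · rw [← mul_assoc, h2, Matrix.smul_mul, mul_assoc, (hV s).2, Matrix.mul_smul, smul_smul,
      mul_comm, star_coe_mul_coe, one_smul, mul_assoc]

end Intertwines

/-- If the intertwiners are jointly injective and the tuple is minimal, then some intertwiner is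
unitary. -/
theorem exists_unitary_intertwiner {ι : Type*} [Fintype ι]
    {A : Fin g → Matrix (Fin d) (Fin d) ℂ} {γ : Fin g → Circle}
    (hmin : IsMinimalDefiningTuple A (freeSpectrahedron A))
    {V : ι → Matrix (Fin d) (Fin d) ℂ} (hV : krausMap V 1 = 1)
    (hVA : ∀ i, Intertwines γ A (V i)) :
    ∃ W, Intertwines γ A W ∧ Wᴴ * W = 1 := by
  -- Kernels of partially isometric intertwiners; a minimal one will be shown to be zero.
  let 𝒮 : Set (Submodule ℂ (Fin d → ℂ)) :=
    {K | ∃ W, Intertwines γ A W ∧ W * Wᴴ * W = W ∧ K = LinearMap.ker W.mulVecLin}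
  obtain ⟨K, ⟨W, hWA, hWp, rfl⟩, hK⟩ := WellFounded.has_min
    (wellFounded_lt (α := Submodule ℂ (Fin d → ℂ))) 𝒮 ⟨_, 0, Intertwines.zero, by simp, rfl⟩
  refine ⟨W, hWA, ?_⟩
  by_contra hne
  set R := 1 - Wᴴ * W with hR
  have hR0 : R ≠ 0 := fun h => hne (sub_eq_zero.mp h).symm
  have hRA : InCommutant A R := (hWA.conjTranspose_mul hWA).one_sub
  have hRh : Rᴴ = R := by simp [hR]
  have hWR : W * R = 0 := by rw [hR, mul_sub, mul_one, ← mul_assoc, hWp, sub_self]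
  have hRW : R * Wᴴ = 0 := by
    have := congrArg Matrix.conjTranspose hWR
    simpa [hRh] using this
  have hRR : R * R = R := by
    rw [hR, sub_mul, one_mul, ← hR, mul_assoc, hWR]
    simp
  -- Unitality makes the `V i` jointly injective, so some `V i` is nonzero on the initial defect
  -- space of `W`.
  obtain ⟨i, hi⟩ : ∃ i, V i * R ≠ 0 := by
    by_contra hcon
    push Not at hcon
    apply hR0
    have h1 : ∑ i, (V i)ᴴ * V i = 1 := by simpa [krausMap_apply] using hV
    calc R = (∑ i, (V i)ᴴ * V i) * R := by rw [h1, one_mul]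
      _ = 0 := by simp only [Finset.sum_mul, mul_assoc, hcon, mul_zero, Finset.sum_const_zero]
  set Z := V i * R with hZ
  have hZA : Intertwines γ A Z := (hVA i).mul_commutant hRA
  -- `Wᴴ * Z` lies in the commutant and squares to zero because `R * Wᴴ = 0`; hence the ranges of
  -- `Z` and `W` are orthogonal.
  have hWZ : Wᴴ * Z = 0 := by
    refine (hWA.conjTranspose_mul hZA).eq_zero_of_mul_self hmin ?_
    rw [hZ]
    calc _ = Wᴴ * V i * (R * Wᴴ) * V i * R := by simp only [mul_assoc]
      _ = 0 := by rw [hRW]; simp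
  obtain ⟨r, P, hr, hP0, hP, hP2, hZP, hPc⟩ := exists_pos_spectral_projection
    (posSemidef_conjTranspose_mul_self Z)
    (fun h => hi (conjTranspose_mul_self_eq_zero.mp h))
  have hPA : InCommutant A P := (hZA.conjTranspose_mul hZA).spectral hPc
  have hr' : (r : ℂ) ≠ 0 := by exact_mod_cast hr.ne'
  have hRP : R * P = P := by
    have h1 : R * (Zᴴ * Z * P) = Zᴴ * Z * P := by
      rw [hZ, Matrix.conjTranspose_mul, hRh]
      simp only [← mul_assoc, hRR]
    rw [hZP, Matrix.mul_smul] at h1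
    exact smul_right_injective _ hr' h1
  have hWP : W * P = 0 := by rw [← hRP, ← mul_assoc, hWR, zero_mul]
  -- Dividing by the square root of `r` makes `Z * P` a partial isometry. Its initial projection `P`
  -- lies under `R` and its range is orthogonal to that of `W`, so adding it to `W` shrinks the
  -- kernel.
  set c : ℂ := (((Real.sqrt r)⁻¹ : ℝ) : ℂ) with hc
  have hcc : star c * c * r = 1 := by
    rw [hc, RCLike.star_def, Complex.conj_ofReal]
    have : (Real.sqrt r)⁻¹ * (Real.sqrt r)⁻¹ * r = 1 := by
      rw [← mul_inv, Real.mul_self_sqrt hr.le, inv_mul_cancel₀ hr.ne']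
    exact_mod_cast this
  set Y := c • (Z * P) with hY
  have hYA : Intertwines γ A Y := (hZA.mul_commutant hPA).smul c
  have hYY : Yᴴ * Y = P := by
    rw [hY, conjTranspose_smul, Matrix.conjTranspose_mul, hP, Matrix.smul_mul, Matrix.mul_smul,
      smul_smul, mul_assoc, ← mul_assoc Zᴴ, hZP, Matrix.mul_smul, hP2, smul_smul, hcc, one_smul]
  have hYP : Y * P = Y := by rw [hY, Matrix.smul_mul, mul_assoc, hP2]
  have hWY : Wᴴ * Y = 0 := by rw [hY, Matrix.mul_smul, ← mul_assoc, hWZ, zero_mul, smul_zero]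
  have hYW : Yᴴ * W = 0 := by
    have := congrArg Matrix.conjTranspose hWY
    simpa using this
  have hgram : (W + Y)ᴴ * (W + Y) = Wᴴ * W + P := by
    rw [conjTranspose_add, add_mul, mul_add, mul_add, hWY, hYW, hYY, add_zero, zero_add]
  have hYWW : Y * (Wᴴ * W) = 0 := by
    have hPW : P * Wᴴ = 0 := by
      have := congrArg Matrix.conjTranspose hWP
      simpa [hP] using this
    rw [← hYP, mul_assoc, ← mul_assoc P, hPW, zero_mul, mul_zero]
  refine hK (LinearMap.ker (W + Y).mulVecLin) ⟨W + Y, hWA.add hYA, ?_, rfl⟩ ?_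
  · rw [mul_assoc, hgram, add_mul, mul_add, mul_add, hWP, hYWW, hYP, ← mul_assoc, hWp]
    simp
  · rw [lt_iff_le_not_ge]
    constructor
    · intro v hv
      rw [LinearMap.mem_ker, mulVecLin_apply] at hv ⊢
      have h1 := congrArg (fun u => W *ᵥ (Wᴴ *ᵥ u)) hv
      simp only [mulVec_mulVec, mulVec_zero] at h1
      rwa [mul_add, hWY, add_zero, ← mul_assoc, hWp] at h1
    · intro hle
      apply hP0
      refine ext_of_mulVec_single fun j => ?_
      have h1 : (P *ᵥ Pi.single j 1) ∈ LinearMap.ker W.mulVecLin := by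
        rw [LinearMap.mem_ker, mulVecLin_apply, mulVec_mulVec, hWP, zero_mulVec]
      have h2 := hle h1
      rw [LinearMap.mem_ker, mulVecLin_apply, mulVec_mulVec, add_mul, hWP, zero_add, hYP] at h2
      rw [← hYY, ← mulVec_mulVec, h2, mulVec_zero, zero_mulVec]

end Intertwiners

/-! ### Completely positive extension by separation of Choi matrices -/

section Extension

open Matrix

section Separation

variable {κ : Type*} [Fintype κ]

theorem exists_conjTranspose_mul_self [DecidableEq κ] {C : Matrix κ κ ℂ} (hC : C.PosSemidef) :
    ∃ B : Matrix κ κ ℂ, C = Bᴴ * B := by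
  open scoped MatrixOrder in
  exact CStarAlgebra.nonneg_iff_eq_star_mul_self.mp hC.nonneg

theorem trace_conjTranspose_mul_self_eq (B : Matrix κ κ ℂ) :
    (Bᴴ * B).trace = ((∑ j, ∑ i, ‖B i j‖ ^ 2 : ℝ) : ℂ) := by
  simp only [trace, diag_apply, mul_apply, conjTranspose_apply, Complex.ofReal_sum,
    Complex.ofReal_pow, RCLike.star_def, Complex.conj_mul']

/-- In `C = Bᴴ * B` the trace is the squared Hilbert-Schmidt norm of `B`, so the set is a continuous
image of a sphere, which is compact (or empty). -/
theorem isCompact_posSemidef_trace_eq [DecidableEq κ] (t : ℝ) :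
    IsCompact {C : Matrix κ κ ℂ | C.PosSemidef ∧ C.trace = t} := by
  have hcomp : IsCompact {B : κ → κ → ℂ | ∑ j, ∑ i, ‖B i j‖ ^ 2 = t} := by
    refine Metric.isCompact_of_isClosed_isBounded ?_ ?_
    · exact isClosed_eq (by fun_prop) continuous_const
    · refine (Metric.isBounded_closedBall (x := 0) (r := Real.sqrt t)).subset fun B hB => ?_
      rw [mem_closedBall_zero_iff, pi_norm_le_iff_of_nonneg (Real.sqrt_nonneg t)]
      intro i
      rw [pi_norm_le_iff_of_nonneg (Real.sqrt_nonneg t)]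
      intro j
      refine Real.le_sqrt_of_sq_le ?_
      have hB' : ∑ j, ∑ i, ‖B i j‖ ^ 2 = t := hB
      rw [← hB']
      calc ‖B i j‖ ^ 2 ≤ ∑ i, ‖B i j‖ ^ 2 :=
            Finset.single_le_sum (f := fun i => ‖B i j‖ ^ 2) (fun _ _ => by positivity)
              (Finset.mem_univ i)
        _ ≤ _ := Finset.single_le_sum (f := fun j => ∑ i, ‖B i j‖ ^ 2)
              (fun _ _ => by positivity) (Finset.mem_univ j)
  have hcont : Continuous fun B : κ → κ → ℂ => (of B)ᴴ * of B := by
    refine continuous_matrix fun i j => ?_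
    simp only [mul_apply, conjTranspose_apply, of_apply]
    fun_prop
  convert hcomp.image hcont using 1
  ext C
  constructor
  · rintro ⟨hC, ht⟩
    obtain ⟨B, rfl⟩ := exists_conjTranspose_mul_self hC
    refine ⟨B, ?_, rfl⟩
    rw [trace_conjTranspose_mul_self_eq] at ht
    exact_mod_cast ht
  · rintro ⟨B, hB, rfl⟩
    refine ⟨posSemidef_conjTranspose_mul_self _, ?_⟩
    rw [trace_conjTranspose_mul_self_eq]
    exact_mod_cast hB

theorem convex_posSemidef_trace_eq (t : ℝ) :
    Convex ℝ {C : Matrix κ κ ℂ | C.PosSemidef ∧ C.trace = t} := by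
  rintro C ⟨hC, hCt⟩ D ⟨hD, hDt⟩ a b ha hb hab
  have e : ∀ (r : ℝ) (M : Matrix κ κ ℂ), r • M = (r : ℂ) • M := fun r M => by
    ext i j
    simp
  refine ⟨?_, ?_⟩
  · rw [e, e]
    exact (posSemidef_real_smul hC ha).add (posSemidef_real_smul hD hb)
  · rw [trace_add, trace_smul, trace_smul, hCt, hDt, ← add_smul, hab, one_smul]

end Separation

variable {g d n m : ℕ}

/-- The maximally entangled vector `∑ᵢ eᵢ ⊗ eᵢ`. -/
def entangledVec (d : ℕ) : Fin d × Fin d → ℂ := fun p => if p.1 = p.2 then 1 else 0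

/-- A bilinear pairing of matrices becomes a quadratic form of their Kronecker product, so the value
of a functional at the target family can be read off a pencil. -/
theorem entangledVec_quadratic (M N : Matrix (Fin d) (Fin d) ℂ) :
    star (entangledVec d) ⬝ᵥ (M ⊗ₖ N) *ᵥ entangledVec d = ∑ i, ∑ j, M i j * N i j := by
  simp only [dotProduct, mulVec, entangledVec, Fintype.sum_prod_type, kroneckerMap_apply,
    Pi.star_apply, mul_ite, mul_one, mul_zero, Finset.sum_ite_eq, Finset.mem_univ, if_true,
    apply_ite (star : ℂ → ℂ), star_one, star_zero, ite_mul, one_mul, zero_mul]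

/-- Either a family of matrices is the image of another one under a completely positive map, or
a linear functional separates it from all such images of a given trace. -/
theorem exists_kraus_or_separation {σ : Type*} [Fintype σ] [DecidableEq σ]
    (B b : σ → Matrix (Fin d) (Fin d) ℂ) :
    (∃ V : Fin d × Fin d → Matrix (Fin d) (Fin d) ℂ, ∀ s, krausMap V (B s) = b s) ∨
    ∃ (q : σ → Matrix (Fin d) (Fin d) ℂ) (u : ℝ),
      (∀ v : Fin d × Fin d → ℂ, v ≠ 0 →
        d * (star v ⬝ᵥ (∑ s, B s ⊗ₖ q s) *ᵥ v).re < u * (star v ⬝ᵥ v).re) ∧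
      u < (star (entangledVec d) ⬝ᵥ (∑ s, b s ⊗ₖ q s) *ᵥ entangledVec d).re := by
  -- `C` plays the role of a Choi matrix, and `Λ C` is the family of images of `B` under its map.
  let Λ : Matrix (Fin d × Fin d) (Fin d × Fin d) ℂ →ₗ[ℂ] (σ → Fin d → Fin d → ℂ) :=
    { toFun := fun C s i j => ∑ x, ∑ y, B s x y * C (y, j) (x, i)
      map_add' := fun C D => by
        ext s i j
        simp only [Matrix.add_apply, mul_add, Finset.sum_add_distrib, Pi.add_apply]
      map_smul' := fun c C => by
        ext s i j
        simp only [Matrix.smul_apply, smul_eq_mul, Finset.mul_sum, Pi.smul_apply, RingHom.id_apply]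
        exact Finset.sum_congr rfl fun x _ => Finset.sum_congr rfl fun y _ => by ring }
  have hΛ : ∀ C s i j, Λ C s i j = ∑ x, ∑ y, B s x y * C (y, j) (x, i) := fun _ _ _ _ => rfl
  have hΛc : Continuous Λ := by
    refine continuous_pi fun s => continuous_pi fun i => continuous_pi fun j => ?_
    simp only [hΛ]
    fun_prop
  -- Fixing the trace gives compactness, and `d` is the trace of the Choi matrix of a unital map.
  set 𝒞 := {C : Matrix (Fin d × Fin d) (Fin d × Fin d) ℂ | C.PosSemidef ∧ C.trace = (d : ℝ)}
    with h𝒞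
  by_cases hmem : (fun s i j => b s i j : σ → Fin d → Fin d → ℂ) ∈ Λ '' 𝒞
  · left
    obtain ⟨C, ⟨hC, -⟩, hCb⟩ := hmem
    obtain ⟨D, rfl⟩ := exists_conjTranspose_mul_self hC
    refine ⟨fun r => of fun x j => star (D r (x, j)), fun s => ?_⟩
    ext i j
    have := congrFun (congrFun (congrFun hCb s) i) j
    rw [← this, hΛ]
    simp only [krausMap_apply, Matrix.sum_apply, mul_apply, conjTranspose_apply, of_apply,
      star_star, Finset.sum_mul, Finset.mul_sum]
    refine Finset.sum_comm.trans ?_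
    refine (Finset.sum_congr rfl fun y _ => Finset.sum_comm).trans ?_
    refine Finset.sum_comm.trans ?_
    exact Finset.sum_congr rfl fun x _ => Finset.sum_congr rfl fun y _ =>
      Finset.sum_congr rfl fun r _ => by ring
  · right
    obtain ⟨f, u, hf, hfb⟩ := RCLike.geometric_hahn_banach_closed_point (𝕜 := ℂ)
      ((convex_posSemidef_trace_eq (κ := Fin d × Fin d) d).linear_image (Λ.restrictScalars ℝ))
      ((isCompact_posSemidef_trace_eq (κ := Fin d × Fin d) d).image hΛc).isClosed hmem
    set q : σ → Matrix (Fin d) (Fin d) ℂ :=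
      fun s => of fun i j => f (Pi.single s (Pi.single i (Pi.single j 1))) with hq
    have hfq : ∀ y : σ → Fin d → Fin d → ℂ, f y = ∑ s, ∑ i, ∑ j, y s i j * q s i j := by
      intro y
      have hy : y = ∑ s, ∑ i, ∑ j, y s i j • (Pi.single s (Pi.single i (Pi.single j 1)) :
          σ → Fin d → Fin d → ℂ) := by
        ext s i j
        simp [Finset.sum_apply, Pi.single_apply, ite_apply]
      conv_lhs => rw [hy]
      simp only [map_sum, map_smul, smul_eq_mul, hq, of_apply]
    have hfΛ : ∀ v : Fin d × Fin d → ℂ,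
        f (Λ (vecMulVec v (star v))) = star v ⬝ᵥ (∑ s, B s ⊗ₖ q s) *ᵥ v := by
      intro v
      rw [hfq, Matrix.sum_mulVec, dotProduct_sum]
      refine Finset.sum_congr rfl fun s _ => ?_
      simp only [hΛ, vecMulVec_apply, dotProduct, mulVec, Pi.star_apply, kroneckerMap_apply,
        Fintype.sum_prod_type, Finset.sum_mul, Finset.mul_sum]
      refine Eq.trans ?_ Finset.sum_comm
      refine Finset.sum_congr rfl fun i _ => ?_
      refine Finset.sum_comm.trans ?_
      refine Finset.sum_congr rfl fun x _ => ?_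
      refine Finset.sum_comm.trans ?_
      exact Finset.sum_congr rfl fun y _ => Finset.sum_congr rfl fun j _ => by ring
    refine ⟨q, u, fun v hv => ?_, ?_⟩
    · have hpos := star_dotProduct_self_pos hv
      have hreal : star v ⬝ᵥ v = (((star v ⬝ᵥ v).re : ℝ) : ℂ) := by
        refine Complex.ext rfl ?_
        have := (isHermitian_one (n := Fin d × Fin d) (α := ℂ)).im_star_dotProduct_mulVec_self v
        simpa using this
      set ν := (star v ⬝ᵥ v).re
      -- The functional is tested on the rank-one Choi matrix of `v`, scaled to trace `d`.
      have := hf _ ⟨((d / ν : ℝ) : ℂ) • vecMulVec v (star v),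
        ⟨posSemidef_real_smul (posSemidef_vecMulVec_self_star v) (by positivity), ?_⟩, rfl⟩
      · change RCLike.re (f (Λ _)) < u at this
        rw [map_smul, map_smul, hfΛ, smul_eq_mul] at this
        change (((d / ν : ℝ) : ℂ) * _).re < u at this
        rw [Complex.re_ofReal_mul, div_mul_eq_mul_div, div_lt_iff₀ hpos] at this
        exact this
      · rw [trace_smul, trace_vecMulVec, dotProduct_comm, hreal, smul_eq_mul, ← Complex.ofReal_mul,
          div_mul_cancel₀ _ hpos.ne']
    · rw [hfq] at hfb
      convert hfb using 1
      simp only [Matrix.sum_mulVec, dotProduct_sum, entangledVec_quadratic]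
      rfl

theorem linPart_compress_right (A : Fin g → Matrix (Fin d) (Fin d) ℂ)
    (X : Fin g → Matrix (Fin n) (Fin n) ℂ) (Z : Matrix (Fin n) (Fin m) ℂ) :
    linPart A (fun s => Zᴴ * X s * Z)
      = ((1 : Matrix (Fin d) (Fin d) ℂ) ⊗ₖ Z)ᴴ * linPart A X
        * ((1 : Matrix (Fin d) (Fin d) ℂ) ⊗ₖ Z) := by
  simp only [linPart, Matrix.mul_sum, Matrix.sum_mul, conjTranspose_kronecker, conjTranspose_one,
    ← mul_kronecker_mul, one_mul, mul_one]

/-- The pencil whose constant coefficient is `1 ⊗ R` instead of the identity. -/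
def affinePencil (A : Fin g → Matrix (Fin d) (Fin d) ℂ) (R : Matrix (Fin n) (Fin n) ℂ)
    (X : Fin g → Matrix (Fin n) (Fin n) ℂ) : Matrix (Fin d × Fin n) (Fin d × Fin n) ℂ :=
  (1 : Matrix (Fin d) (Fin d) ℂ) ⊗ₖ R - linPart A X - (linPart A X)ᴴ

theorem affinePencil_one (A : Fin g → Matrix (Fin d) (Fin d) ℂ)
    (X : Fin g → Matrix (Fin n) (Fin n) ℂ) : affinePencil A 1 X = pencil A X := by
  rw [affinePencil, one_kronecker_one, pencil]

theorem affinePencil_compress (A : Fin g → Matrix (Fin d) (Fin d) ℂ) (R : Matrix (Fin n) (Fin n) ℂ)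
    (X : Fin g → Matrix (Fin n) (Fin n) ℂ) (Z : Matrix (Fin n) (Fin m) ℂ) :
    affinePencil A (Zᴴ * R * Z) (fun s => Zᴴ * X s * Z)
      = ((1 : Matrix (Fin d) (Fin d) ℂ) ⊗ₖ Z)ᴴ * affinePencil A R X
        * ((1 : Matrix (Fin d) (Fin d) ℂ) ⊗ₖ Z) := by
  have h : (1 : Matrix (Fin d) (Fin d) ℂ) ⊗ₖ (Zᴴ * R * Z)
      = ((1 : Matrix (Fin d) (Fin d) ℂ) ⊗ₖ Z)ᴴ * ((1 : Matrix (Fin d) (Fin d) ℂ) ⊗ₖ R)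
        * ((1 : Matrix (Fin d) (Fin d) ℂ) ⊗ₖ Z) := by
    simp only [conjTranspose_kronecker, conjTranspose_one, ← mul_kronecker_mul, one_mul]
  rw [affinePencil, h, linPart_compress_right, affinePencil]
  simp only [Matrix.mul_sub, Matrix.sub_mul, Matrix.conjTranspose_mul, conjTranspose_conjTranspose,
    Matrix.mul_assoc]

/-- In the Reinhardt case the constant coefficient of a positive definite affine pencil is positive
definite. -/
theorem IsReinhardt.posDef_of_affinePencil {A : Fin g → Matrix (Fin d) (Fin d) ℂ} (hd : 0 < d)
    (hR : IsReinhardt (freeSpectrahedron A)) {R : Matrix (Fin n) (Fin n) ℂ} (hRh : R.IsHermitian)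
    {X : Fin g → Matrix (Fin n) (Fin n) ℂ} (h : (affinePencil A R X).PosDef) : R.PosDef := by
  refine PosDef.of_dotProduct_mulVec_pos hRh fun z hz => ?_
  rw [Complex.pos_iff]
  refine ⟨?_, (hRh.im_star_dotProduct_mulVec_self z).symm⟩
  by_contra hle
  rw [not_lt] at hle
  set Z : Matrix (Fin n) (Fin 1) ℂ := of fun i _ => z i with hZ
  set r := (star z ⬝ᵥ R *ᵥ z).re with hr
  have hZR : Zᴴ * R * Z = (r : ℂ) • 1 := by
    ext i j
    have hij : i = j := Subsingleton.elim _ _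
    have hval : (Zᴴ * R * Z) i j = star z ⬝ᵥ R *ᵥ z := by
      rw [Matrix.mul_assoc]
      simp only [mul_apply, hZ, conjTranspose_apply, of_apply, dotProduct, mulVec, Pi.star_apply]
    rw [hval, hij, Matrix.smul_apply, one_apply_eq, smul_eq_mul, mul_one]
    exact Complex.ext rfl (hRh.im_star_dotProduct_mulVec_self z)
  set x : Fin g → Matrix (Fin 1) (Fin 1) ℂ := fun s => Zᴴ * X s * Z with hx
  set N := linPart A x + (linPart A x)ᴴ with hN
  have hinj : Function.Injective ((1 : Matrix (Fin d) (Fin d) ℂ) ⊗ₖ Z).mulVec := by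
    intro v w hvw
    obtain ⟨i, hi⟩ := Function.ne_iff.mp hz
    ext ⟨a, k⟩
    have := congrFun hvw (a, i)
    simp only [mulVec, dotProduct, kroneckerMap_apply, Fintype.sum_prod_type, one_apply, hZ,
      of_apply, ite_mul, one_mul, zero_mul, Finset.univ_unique, Finset.sum_singleton,
      Finset.sum_ite_eq, Finset.mem_univ, if_true] at this
    rw [Subsingleton.elim k default]
    exact mul_left_cancel₀ hi this
  -- Compression to `z` gives `r • 1 - N ≻ 0` with `r ≤ 0`. Then `t • x` lies in the set for all `t
  -- ≥ 0`, hence so does `-t • x`, which is impossible for large `t`.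
  have hNpos : (-N).PosDef := by
    have h1 := h.conjTranspose_mul_mul_same hinj
    rw [← affinePencil_compress, hZR] at h1
    have h2 := posSemidef_real_smul
      (PosSemidef.one : (1 : Matrix (Fin d × Fin 1) (Fin d × Fin 1) ℂ).PosSemidef)
      (r := -r) (by linarith)
    have h3 := h1.add_posSemidef h2
    convert h3 using 1
    rw [affinePencil, kronecker_smul, one_kronecker_one, Complex.ofReal_neg, neg_smul, hN]
    abel
  have hpen : ∀ t : ℝ, pencil A (fun s => (t : ℂ) • x s) = 1 - (t : ℂ) • N := by
    intro t
    have : linPart A (fun s => (t : ℂ) • x s) = (t : ℂ) • linPart A x := by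
      simp only [linPart, kronecker_smul, Finset.smul_sum]
    rw [pencil, this, conjTranspose_smul, RCLike.star_def, Complex.conj_ofReal, hN, smul_add]
    abel
  set e : Fin d × Fin 1 → ℂ := Pi.single (⟨0, hd⟩, 0) 1 with he
  have he0 : e ≠ 0 := by
    intro h0
    have := congrFun h0 (⟨0, hd⟩, 0)
    simp [he] at this
  have hNe := (Complex.pos_iff.mp (hNpos.dotProduct_mulVec_pos he0)).1
  rw [neg_mulVec, dotProduct_neg, Complex.neg_re] at hNe
  obtain ⟨t, ht⟩ := exists_nat_gt ((star e ⬝ᵥ e).re / -(star e ⬝ᵥ N *ᵥ e).re)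
  have hmem : (fun s => ((t : ℝ) : ℂ) • x s) ∈ freeSpectrahedron A 1 := by
    rw [mem_freeSpectrahedron, hpen, sub_eq_add_neg, ← smul_neg]
    exact PosSemidef.one.add (posSemidef_real_smul hNpos.posSemidef t.cast_nonneg)
  have hneg := hR 1 _ hmem fun _ => -1
  have hneg' : (pencil A (fun s => ((-t : ℝ) : ℂ) • x s)).PosSemidef := by
    rw [mem_freeSpectrahedron] at hneg
    convert hneg using 3
    simp
  rw [hpen] at hneg'
  have := re_nonneg_of_posSemidef hneg' e
  rw [sub_mulVec, one_mulVec, smul_mulVec, dotProduct_sub, dotProduct_smul, smul_eq_mul,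
    Complex.sub_re, Complex.re_ofReal_mul] at this
  rw [div_lt_iff₀ hNe] at ht
  linarith

/-- For a Reinhardt free spectrahedron, a unital completely positive map scales the coefficients by
any prescribed unimodular factors. -/
theorem IsReinhardt.exists_kraus {A : Fin g → Matrix (Fin d) (Fin d) ℂ} (hd : 0 < d)
    (hR : IsReinhardt (freeSpectrahedron A)) (γ : Fin g → Circle) :
    ∃ V : Fin d × Fin d → Matrix (Fin d) (Fin d) ℂ,
      krausMap V 1 = 1 ∧ ∀ s, krausMap V (A s) = (γ s : ℂ) • A s := by
  -- The index `none` carries the identity, so unitality is one more interpolation condition.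
  rcases exists_kraus_or_separation (σ := Option (Fin g)) (fun o => o.elim 1 A)
    (fun o => o.elim 1 fun s => (γ s : ℂ) • A s) with ⟨V, hV⟩ | ⟨q, u, hq, hu⟩
  · exact ⟨V, hV none, fun s => hV (some s)⟩
  exfalso
  simp only [Fintype.sum_option, Option.elim_none, Option.elim_some] at hq hu
  set q₁ : Fin g → Matrix (Fin d) (Fin d) ℂ := fun s => q (some s) with hq₁
  change ∀ v : Fin d × Fin d → ℂ, v ≠ 0 →
    d * (star v ⬝ᵥ ((1 : Matrix (Fin d) (Fin d) ℂ) ⊗ₖ q none + linPart A q₁) *ᵥ v).re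
      < u * (star v ⬝ᵥ v).re at hq
  have hu' : u < (star (entangledVec d) ⬝ᵥ ((1 : Matrix (Fin d) (Fin d) ℂ) ⊗ₖ q none
      + linPart A (fun s => (γ s : ℂ) • q₁ s)) *ᵥ entangledVec d).re := by
    rw [linPart_smul_comm]
    exact hu
  have hd' : (0 : ℝ) < d := by exact_mod_cast hd
  -- This constant term turns the strict separation inequality into positive definiteness of the
  -- affine pencil at `q₁`.
  set R := ((2 * u / d : ℝ) : ℂ) • 1 - q none - (q none)ᴴ with hRdef
  have hRh : R.IsHermitian := by
    rw [IsHermitian, hRdef]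
    simp only [conjTranspose_sub, conjTranspose_smul, conjTranspose_one, conjTranspose_conjTranspose,
      RCLike.star_def, Complex.conj_ofReal]
    abel
  have hform : ∀ (y : Fin g → Matrix (Fin d) (Fin d) ℂ) (v : Fin d × Fin d → ℂ),
      (star v ⬝ᵥ affinePencil A R y *ᵥ v).re = 2 * u / d * (star v ⬝ᵥ v).re
        - 2 * (star v ⬝ᵥ ((1 : Matrix (Fin d) (Fin d) ℂ) ⊗ₖ q none + linPart A y) *ᵥ v).re := by
    intro y v
    set G := (1 : Matrix (Fin d) (Fin d) ℂ) ⊗ₖ q none + linPart A y with hG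
    have e1 : affinePencil A R y = ((2 * u / d : ℝ) : ℂ) • 1 - G - Gᴴ := by
      have : (1 : Matrix (Fin d) (Fin d) ℂ) ⊗ₖ R
          = ((2 * u / d : ℝ) : ℂ) • 1 - (1 : Matrix (Fin d) (Fin d) ℂ) ⊗ₖ q none
            - (1 : Matrix (Fin d) (Fin d) ℂ) ⊗ₖ (q none)ᴴ := by
        refine eq_sub_of_add_eq (eq_sub_of_add_eq ?_)
        rw [← kronecker_add, ← kronecker_add, hRdef, sub_add_cancel, sub_add_cancel,
          kronecker_smul, one_kronecker_one]
      rw [affinePencil, this, hG, conjTranspose_add, conjTranspose_kronecker, conjTranspose_one]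
      abel
    have e2 : (star v ⬝ᵥ Gᴴ *ᵥ v).re = (star v ⬝ᵥ G *ᵥ v).re := by
      have : star v ⬝ᵥ Gᴴ *ᵥ v = star (star v ⬝ᵥ G *ᵥ v) := by
        rw [star_dotProduct, star_mulVec, conjTranspose_conjTranspose, dotProduct_mulVec]
      rw [this, RCLike.star_def, Complex.conj_re]
    rw [e1, sub_mulVec, sub_mulVec, smul_mulVec, one_mulVec, dotProduct_sub, dotProduct_sub,
      dotProduct_smul, smul_eq_mul, Complex.sub_re, Complex.sub_re, Complex.re_ofReal_mul, e2]
    ring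
  have haff : ∀ y, (affinePencil A R y).IsHermitian := by
    intro y
    rw [IsHermitian, affinePencil, conjTranspose_sub, conjTranspose_sub, conjTranspose_conjTranspose,
      conjTranspose_kronecker, conjTranspose_one, hRh.eq]
    abel
  have hPD : (affinePencil A R q₁).PosDef := by
    refine PosDef.of_dotProduct_mulVec_pos (haff _) fun v hv => ?_
    rw [Complex.pos_iff]
    refine ⟨?_, ((haff _).im_star_dotProduct_mulVec_self v).symm⟩
    have h1 := hq v hv
    rw [hform, div_mul_eq_mul_div, sub_pos, lt_div_iff₀ hd']
    linarith
  have hRpos := hR.posDef_of_affinePencil hd hRh hPD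
  obtain ⟨T, hT⟩ := exists_conjTranspose_mul_self hRpos.posSemidef
  have hTu : IsUnit T := by
    have := hRpos.isUnit
    rw [hT] at this
    exact isUnit_of_mul_isUnit_right this
  have hTT : T * T⁻¹ = 1 := mul_nonsing_inv T ((isUnit_iff_isUnit_det T).mp hTu)
  have hTT' : T⁻¹ * T = 1 := nonsing_inv_mul T ((isUnit_iff_isUnit_det T).mp hTu)
  have hmem : (fun s => T⁻¹ᴴ * q₁ s * T⁻¹) ∈ freeSpectrahedron A d := by
    have h1 := hPD.posSemidef.conjTranspose_mul_mul_same ((1 : Matrix (Fin d) (Fin d) ℂ) ⊗ₖ T⁻¹)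
    rw [← affinePencil_compress, hT] at h1
    have h2 : T⁻¹ᴴ * (Tᴴ * T) * T⁻¹ = 1 := by
      rw [mul_assoc, mul_assoc, hTT, mul_one, ← conjTranspose_mul, hTT, conjTranspose_one]
    rw [h2, affinePencil_one] at h1
    exact h1
  have hγ := hR d _ hmem γ
  rw [mem_freeSpectrahedron, ← affinePencil_one] at hγ
  have h1 := hγ.conjTranspose_mul_mul_same ((1 : Matrix (Fin d) (Fin d) ℂ) ⊗ₖ T)
  rw [← affinePencil_compress, mul_one, ← hT] at h1
  have h2 : ∀ s, Tᴴ * ((γ s : ℂ) • (T⁻¹ᴴ * q₁ s * T⁻¹)) * T = (γ s : ℂ) • q₁ s := by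
    intro s
    rw [Matrix.mul_smul, Matrix.smul_mul]
    congr 1
    calc _ = (Tᴴ * T⁻¹ᴴ) * q₁ s * (T⁻¹ * T) := by simp only [mul_assoc]
      _ = _ := by rw [← conjTranspose_mul, hTT', conjTranspose_one, one_mul, mul_one]
  simp only [h2] at h1
  -- After normalizing by `T`, rotating and undoing the normalization, the affine pencil at `γ • q₁`
  -- is positive. At the entangled vector, of squared norm `d`, this contradicts `hu'`.
  have h3 := re_nonneg_of_posSemidef h1 (entangledVec d)
  have hnorm : star (entangledVec d) ⬝ᵥ entangledVec d = d := by
    have := entangledVec_quadratic (1 : Matrix (Fin d) (Fin d) ℂ) 1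
    rw [one_kronecker_one, one_mulVec] at this
    rw [this]
    simp [one_apply]
  rw [hform, hnorm, Complex.natCast_re, div_mul_cancel₀ _ hd'.ne'] at h3
  linarith

end Extension

/-! ### Independent circle points, walk weights and potentials -/

section Potentials

/-- There are multiplicatively independent points of the unit circle. -/
theorem exists_circle_independent (g : ℕ) :
    ∃ γ : Fin g → Circle, ∀ k : Fin g → ℤ, ∏ s, γ s ^ k s = 1 → k = 0 := by
  have hinf : Infinite (Module.Basis.ofVectorSpaceIndex ℚ ℝ) := by
    rw [Cardinal.infinite_iff, (Module.Basis.ofVectorSpace ℚ ℝ).mk_eq_rank'', Real.rank_rat_real]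
    exact Cardinal.aleph0_le_continuum
  let e := Infinite.natEmbedding (Module.Basis.ofVectorSpaceIndex ℚ ℝ)
  let θ : Fin (g + 1) → ℝ := fun i => Module.Basis.ofVectorSpace ℚ ℝ (e i)
  have hθ : LinearIndependent ℚ θ := (Module.Basis.ofVectorSpace ℚ ℝ).linearIndependent.comp
    (fun i : Fin (g + 1) => e i) (e.injective.comp Fin.val_injective)
  have h0 : θ 0 ≠ 0 := hθ.ne_zero 0
  -- A multiplicative relation becomes `∑ k s * θ (s + 1) = n * θ 0`, where the integer `n` comes
  -- from the period; this is excluded by rational independence including `θ 0`.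
  refine ⟨fun s => Circle.exp (2 * Real.pi * θ s.succ / θ 0), fun k hk => ?_⟩
  have hexp : ∀ (S : Finset (Fin g)) (f : Fin g → ℝ),
      Circle.exp (∑ s ∈ S, f s) = ∏ s ∈ S, Circle.exp (f s) := by
    classical
    intro S f
    induction S using Finset.induction_on with
    | empty => simp
    | insert a S ha ih => rw [Finset.sum_insert ha, Finset.prod_insert ha, Circle.exp_add, ih]
  simp only [← Circle.exp_zsmul] at hk
  rw [← hexp, Circle.exp_eq_one] at hk
  obtain ⟨n, hn⟩ := hk
  have hsum : ∑ s : Fin g, (k s : ℝ) * θ s.succ = n * θ 0 := by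
    have h1 : ∑ s : Fin g, k s • (2 * Real.pi * θ s.succ / θ 0)
        = (2 * Real.pi / θ 0) * ∑ s : Fin g, (k s : ℝ) * θ s.succ := by
      rw [Finset.mul_sum]
      exact Finset.sum_congr rfl fun s _ => by rw [zsmul_eq_mul]; ring
    rw [h1] at hn
    have hpi := Real.pi_ne_zero
    field_simp at hn
    linarith
  rw [Fintype.linearIndependent_iff] at hθ
  have hz := hθ (Fin.cons (-(n : ℚ)) fun s => (k s : ℚ)) (by
    rw [Fin.sum_univ_succ]
    simp only [Fin.cons_zero, Fin.cons_succ, Rat.smul_def, Rat.cast_neg, Rat.cast_intCast]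
    rw [hsum]
    ring)
  ext s
  have := hz s.succ
  simpa using this

section Walks

variable {V ι : Type*} [Fintype ι] {G : SimpleGraph V}

open Classical in
/-- The product of the factors `γ s`, inverted on backward edges, over an edge. -/
noncomputable def edgeWeight (γ : ι → Circle) (P : ι → Set (V × V)) (u v : V) : Circle :=
  ∏ s, γ s ^ ((if (u, v) ∈ P s then 1 else 0 : ℤ) - (if (v, u) ∈ P s then 1 else 0 : ℤ))

open Classical in
/-- The product of the factors `γ s`, inverted on backward edges, along a walk. -/
noncomputable def walkWeight (γ : ι → Circle) (P : ι → Set (V × V)) {u v : V} (p : G.Walk u v) :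
    Circle :=
  ∏ s, γ s ^ ((p.darts.countP (fun e => (e.fst, e.snd) ∈ P s) : ℤ) -
    (p.darts.countP (fun e => (e.snd, e.fst) ∈ P s) : ℤ))

variable {γ : ι → Circle} {P : ι → Set (V × V)}

theorem edgeWeight_symm (u v : V) : edgeWeight γ P v u = (edgeWeight γ P u v)⁻¹ := by
  rw [edgeWeight, edgeWeight, ← Finset.prod_inv_distrib]
  exact Finset.prod_congr rfl fun s _ => by rw [← zpow_neg, neg_sub]

theorem edgeWeight_eq {u v : V} {s : ι} (hs : (u, v) ∈ P s) (hdisj : ∀ t, (u, v) ∈ P t → t = s)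
    (hback : ∀ t, (v, u) ∉ P t) : edgeWeight γ P u v = γ s := by
  classical
  rw [edgeWeight, Finset.prod_eq_single s]
  · simp [hs, hback]
  · intro t _ hts
    have : (u, v) ∉ P t := fun h => hts (hdisj t h)
    simp [this, hback]
  · simp

@[simp]
theorem walkWeight_nil (u : V) : walkWeight γ P (SimpleGraph.Walk.nil : G.Walk u u) = 1 := by
  simp [walkWeight]

theorem walkWeight_cons {u v w : V} (h : G.Adj u v) (p : G.Walk v w) :
    walkWeight γ P (SimpleGraph.Walk.cons h p) = edgeWeight γ P u v * walkWeight γ P p := by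
  classical
  rw [walkWeight, walkWeight, edgeWeight, ← Finset.prod_mul_distrib]
  refine Finset.prod_congr rfl fun s _ => ?_
  rw [← zpow_add, SimpleGraph.Walk.darts_cons, List.countP_cons, List.countP_cons]
  congr 1
  simp only [decide_eq_true_eq, Nat.cast_add, Nat.cast_ite, Nat.cast_one, Nat.cast_zero]
  ring

theorem walkWeight_append {u v w : V} (p : G.Walk u v) (q : G.Walk v w) :
    walkWeight γ P (p.append q) = walkWeight γ P p * walkWeight γ P q := by
  induction p with
  | nil => simp
  | cons h p ih => rw [SimpleGraph.Walk.cons_append, walkWeight_cons, walkWeight_cons, ih, mul_assoc]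

theorem walkWeight_reverse {u v : V} (p : G.Walk u v) :
    walkWeight γ P p.reverse = (walkWeight γ P p)⁻¹ := by
  induction p with
  | nil => simp
  | cons h p ih =>
    rw [SimpleGraph.Walk.reverse_cons, walkWeight_append, ih, walkWeight_cons, walkWeight_cons,
      walkWeight_nil, mul_one, edgeWeight_symm, mul_inv, mul_comm]

theorem walkWeight_of_isNeutral {v : V} {p : G.Walk v v} (h : IsNeutral P p) :
    walkWeight γ P p = 1 := by
  rw [walkWeight]
  refine Finset.prod_eq_one fun s _ => ?_
  rw [h s, sub_self, zpow_zero]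

/-- A path that closes up with an edge has the inverse weight if all cycles have weight one. -/
theorem walkWeight_cons_eq_one (hc : ∀ (v : V) (p : G.Walk v v), p.IsCycle → walkWeight γ P p = 1)
    {u v : V} (h : G.Adj u v) {p : G.Walk v u} (hp : p.IsPath) :
    walkWeight γ P (SimpleGraph.Walk.cons h p) = 1 := by
  -- If the closing edge already lies on the path, the path is that edge alone and the walk goes
  -- back and forth; otherwise the walk is a genuine cycle.
  by_cases hmem : s(u, v) ∈ p.edges
  · cases p with
    | nil => simp at hmem
    | @cons _ w _ h' q =>
      rw [SimpleGraph.Walk.cons_isPath_iff] at hp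
      rw [SimpleGraph.Walk.edges_cons, List.mem_cons] at hmem
      have hw : w = u := by
        rcases hmem with hm | hm
        · rw [Sym2.eq_iff] at hm
          rcases hm with ⟨h1, h2⟩ | ⟨h1, h2⟩
          · exact absurd (h1 ▸ h) (G.loopless.irrefl _)
          · exact h1.symm
        · exact absurd (q.snd_mem_support_of_mem_edges hm) hp.2
      subst hw
      have hq : q = SimpleGraph.Walk.nil := (SimpleGraph.Walk.isPath_iff_nil.mp hp.1).eq_nil
      rw [hq, walkWeight_cons, walkWeight_cons, walkWeight_nil, mul_one, edgeWeight_symm w v,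
        mul_inv_cancel]
  · exact hc u _ ((SimpleGraph.Walk.cons_isCycle_iff p h).mpr ⟨hp, hmem⟩)

/-- When prepending an edge returns to a vertex of the path, the loop so formed has weight one and
can be cut off. -/
theorem exists_path_walkWeight_eq
    (hc : ∀ (v : V) (p : G.Walk v v), p.IsCycle → walkWeight γ P p = 1) {u v : V}
    (p : G.Walk u v) : ∃ q : G.Walk u v, q.IsPath ∧ walkWeight γ P q = walkWeight γ P p := by
  classical
  induction p with
  | nil => exact ⟨.nil, .nil, rfl⟩
  | @cons u w v h p ih =>
    obtain ⟨q, hq, hqp⟩ := ih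
    by_cases hu : u ∈ q.support
    · refine ⟨q.dropUntil u hu, hq.dropUntil hu, ?_⟩
      have h1 := walkWeight_cons_eq_one hc h (hq.takeUntil hu)
      rw [walkWeight_cons] at h1
      rw [walkWeight_cons, ← hqp]
      conv_rhs => rw [← q.take_spec hu]
      rw [walkWeight_append, ← mul_assoc, h1, one_mul]
    · exact ⟨.cons h q, hq.cons hu, by rw [walkWeight_cons, walkWeight_cons, hqp]⟩

theorem walkWeight_closed
    (hc : ∀ (v : V) (p : G.Walk v v), p.IsCycle → walkWeight γ P p = 1) {v : V}
    (p : G.Walk v v) : walkWeight γ P p = 1 := by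
  obtain ⟨q, hq, hqp⟩ := exists_path_walkWeight_eq hc p
  rw [← hqp, (SimpleGraph.Walk.isPath_iff_nil.mp hq).eq_nil, walkWeight_nil]

/-- A Reinhardt partition of a dag carries a potential for all factors `γ`. -/
theorem IsReinhardtPartition.exists_potential {E : Set (V × V)} (hE : IsDag E)
    (hP : IsReinhardtPartition E P) (γ : ι → Circle) :
    ∃ θ : V → Circle, ∀ s u v, (u, v) ∈ P s → θ v = γ s * θ u := by
  classical
  have hc : ∀ (v : V) (p : (undirected E).Walk v v), p.IsCycle → walkWeight γ P p = 1 :=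
    fun v p hp => walkWeight_of_isNeutral (hP.neutral v p hp)
  have hwalk : ∀ v : V,
      Nonempty ((undirected E).Walk ((undirected E).connectedComponentMk v).out v) :=
    fun v => SimpleGraph.ConnectedComponent.exact
      (Quot.out_eq ((undirected E).connectedComponentMk v))
  -- One base point is fixed in each connected component; the potential is the weight of any walk
  -- from it.
  let W := fun v => (hwalk v).some
  refine ⟨fun v => walkWeight γ P (W v), fun s u v huv => ?_⟩
  have hmemE : ∀ {t a b}, (a, b) ∈ P t → (a, b) ∈ E := fun {t a b} h =>
    hP.union ▸ Set.mem_iUnion.mpr ⟨t, h⟩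
  have huE := hmemE huv
  have hne : u ≠ v := by
    rintro rfl
    exact hE u (.single huE)
  have hadj : (undirected E).Adj u v := by
    rw [undirected, SimpleGraph.fromRel_adj]
    exact ⟨hne, Or.inl huE⟩
  have hw : edgeWeight γ P u v = γ s := by
    refine edgeWeight_eq huv (fun t ht => ?_) fun t ht => ?_
    · by_contra hts
      exact (Set.disjoint_left.mp (hP.disjoint t s hts)) ht huv
    · exact hE u (.tail (.single huE) (hmemE ht))
  have hcomp : (undirected E).connectedComponentMk u = (undirected E).connectedComponentMk v :=
    SimpleGraph.ConnectedComponent.sound hadj.reachable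
  -- The base points of `u` and `v` are only propositionally equal, so they are generalized before
  -- the walks are joined.
  have key : ∀ (r r' : V) (_ : r = r') (p : (undirected E).Walk r u) (q : (undirected E).Walk r' v),
      walkWeight γ P q = γ s * walkWeight γ P p := by
    rintro r _ rfl p q
    have := walkWeight_closed hc (p.append (.cons hadj q.reverse))
    rw [walkWeight_append, walkWeight_cons, hw, walkWeight_reverse] at this
    rw [← mul_assoc, mul_inv_eq_one] at this
    rw [← this, mul_comm]
  exact key _ _ (by rw [hcomp]) _ _

/-- A potential for multiplicatively independent factors exists only over a dag. -/
theorem isDag_of_potential {θ : V → Circle} (hγ : ∀ k : ι → ℤ, ∏ s, γ s ^ k s = 1 → k = 0)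
    (h : ∀ s u v, (u, v) ∈ P s → θ v = γ s * θ u) : IsDag (⋃ s, P s) := by
  classical
  -- A directed path multiplies `θ` by a monomial in the `γ s` with nonnegative exponents, not all
  -- zero, so by independence it cannot close up.
  have key : ∀ {u v}, Relation.TransGen (fun a b => (a, b) ∈ ⋃ s, P s) u v →
      ∃ k : ι → ℕ, k ≠ 0 ∧ θ v = (∏ s, γ s ^ k s) * θ u := by
    intro u v huv
    induction huv with
    | single hab =>
      obtain ⟨s, hs⟩ := Set.mem_iUnion.mp hab
      refine ⟨Pi.single s 1, by simp, ?_⟩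
      rw [h s _ _ hs]
      congr 1
      rw [Finset.prod_eq_single s] <;> simp +contextual
    | tail _ hab ih =>
      obtain ⟨k, hk, hkθ⟩ := ih
      obtain ⟨s, hs⟩ := Set.mem_iUnion.mp hab
      refine ⟨k + Pi.single s 1, ?_, ?_⟩
      · intro h0
        have := congrFun h0 s
        simp at this
      · rw [h s _ _ hs, hkθ]
        simp only [Pi.add_apply, pow_add, Finset.prod_mul_distrib]
        have : ∏ t, γ t ^ (Pi.single s 1 : ι → ℕ) t = γ s := by
          rw [Finset.prod_eq_single s] <;> simp +contextual
        rw [this, mul_left_comm, mul_assoc]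
  intro v hv
  obtain ⟨k, hk, hkθ⟩ := key hv
  have h1 : ∏ s, γ s ^ k s = 1 := by
    rw [← mul_eq_right (b := θ v)]
    exact hkθ.symm
  have h2 := hγ (fun s => k s) (by simpa using h1)
  apply hk
  ext s
  simpa using congrFun h2 s

/-- A potential for multiplicatively independent factors makes the family of edge sets a Reinhardt
partition. -/
theorem isReinhardtPartition_of_potential {θ : V → Circle}
    (hγ : ∀ k : ι → ℤ, ∏ s, γ s ^ k s = 1 → k = 0)
    (h : ∀ s u v, (u, v) ∈ P s → θ v = γ s * θ u) : IsReinhardtPartition (⋃ s, P s) P := by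
  classical
  have hsingle : ∀ s, ∏ t, γ t ^ (Pi.single s 1 : ι → ℤ) t = γ s := by
    intro s
    rw [Finset.prod_eq_single s] <;> simp +contextual
  have hdisj : ∀ s t u v, (u, v) ∈ P s → (u, v) ∈ P t → s = t := by
    intro s t u v hs ht
    have h1 : γ s = γ t := mul_right_cancel ((h s _ _ hs).symm.trans (h t _ _ ht))
    by_contra hst
    have h2 := hγ (Pi.single s 1 - Pi.single t 1) (by
      simp only [Pi.sub_apply, zpow_sub, Finset.prod_mul_distrib, Finset.prod_inv_distrib,
        hsingle]
      rw [h1, mul_inv_cancel])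
    have := congrFun h2 s
    simp [hst] at this
  have hdag := isDag_of_potential hγ h
  have hedge : ∀ s u v, (u, v) ∈ P s → edgeWeight γ P u v = γ s := by
    intro s u v hs
    refine edgeWeight_eq hs (fun t ht => hdisj t s u v ht hs) fun t ht => ?_
    exact hdag u (.tail (.single (Set.mem_iUnion.mpr ⟨s, hs⟩)) (Set.mem_iUnion.mpr ⟨t, ht⟩))
  refine ⟨fun s t hst => Set.disjoint_left.mpr ?_, rfl, fun v L _ => ?_⟩
  · rintro ⟨u, v⟩ hs ht
    exact hst (hdisj s t u v hs ht)
  -- The potential changes along any walk by the weight of the walk, whose exponents are forward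
  -- minus backward counts; on a closed walk independence makes them all zero.
  · have hwalk : ∀ {u v : V} (p : (undirected (⋃ s, P s)).Walk u v),
        θ v = walkWeight γ P p * θ u := by
      intro u v p
      induction p with
      | nil => simp
      | cons hadj p ih =>
        rw [undirected, SimpleGraph.fromRel_adj] at hadj
        rw [walkWeight_cons, ih]
        rcases hadj.2 with he | he
        · obtain ⟨s, hs⟩ := Set.mem_iUnion.mp he
          rw [h s _ _ hs, hedge s _ _ hs, mul_comm (γ s) (walkWeight γ P p), mul_assoc]
        · obtain ⟨s, hs⟩ := Set.mem_iUnion.mp he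
          rw [edgeWeight_symm, hedge s _ _ hs, h s _ _ hs, mul_comm (γ s)⁻¹, mul_assoc,
            inv_mul_cancel_left]
    have h1 : walkWeight γ P L = 1 := by
      rw [← mul_eq_right (b := θ v)]
      exact (hwalk L).symm
    have h2 := hγ _ h1
    intro s
    have := congrFun h2 s
    simp only [Pi.zero_apply] at this
    exact_mod_cast sub_eq_zero.mp this

end Walks

end Potentials

/-! ### Orthogonal decompositions and unitary intertwiners -/

section Decompositions

open Matrix

variable {g d m : ℕ}

section Eigenspaces

variable {E : Type*} [NormedAddCommGroup E] [InnerProductSpace ℂ E]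

/-- An isometry of a finite-dimensional space maps an invariant subspace onto itself, so the
orthogonal complement is an invariant complement. -/
theorem isSemisimple_of_inner_map_map [FiniteDimensional ℂ E] {f : Module.End ℂ E}
    (hf : ∀ x y, inner ℂ (f x) (f y) = inner ℂ x y) : f.IsSemisimple := by
  have hinj : Function.Injective f := by
    rw [← LinearMap.ker_eq_bot, LinearMap.ker_eq_bot']
    intro x hx
    rw [← inner_self_eq_zero (𝕜 := ℂ), ← hf, hx, inner_zero_left]
  rw [Module.End.isSemisimple_iff]
  intro p hp
  refine ⟨pᗮ, ?_, p.isCompl_orthogonal⟩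
  rw [Module.End.mem_invtSubmodule] at hp ⊢
  have hmap : p.map f = p := by
    refine Submodule.eq_of_le_of_finrank_eq (Submodule.map_le_iff_le_comap.mpr hp) ?_
    exact (LinearEquiv.finrank_eq (Submodule.equivMapOfInjective f hinj p)).symm
  intro x hx
  rw [Submodule.mem_comap, Submodule.mem_orthogonal]
  intro y hy
  rw [← hmap] at hy
  obtain ⟨z, hz, rfl⟩ := hy
  rw [hf]
  exact (Submodule.mem_orthogonal _ _).mp hx z hz

theorem star_mul_self_of_eigenvector {f : Module.End ℂ E}
    (hf : ∀ x y, inner ℂ (f x) (f y) = inner ℂ x y) {μ : ℂ} {x : E} (hx : f x = μ • x)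
    (hx0 : x ≠ 0) : star μ * μ = 1 := by
  have h := hf x x
  rw [hx, inner_smul_left, inner_smul_right, ← mul_assoc] at h
  exact mul_right_cancel₀ (inner_self_ne_zero.mpr hx0) (h.trans (one_mul _).symm)

theorem inner_eq_zero_of_eigenvectors {f : Module.End ℂ E}
    (hf : ∀ x y, inner ℂ (f x) (f y) = inner ℂ x y) {μ ν : ℂ} (hne : μ ≠ ν) {x y : E}
    (hx : f x = μ • x) (hy : f y = ν • y) : inner ℂ x y = (0 : ℂ) := by
  by_contra hxy
  have hx0 : x ≠ 0 := by
    rintro rfl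
    simp at hxy
  have h1 := star_mul_self_of_eigenvector hf hx hx0
  have h := hf x y
  rw [hx, hy, inner_smul_left, inner_smul_right, ← mul_assoc] at h
  have h2 : star μ * ν = 1 := mul_right_cancel₀ hxy (h.trans (one_mul _).symm)
  exact hne (mul_left_cancel₀ (left_ne_zero_of_mul_eq_one h1) (h1.trans h2.symm))

end Eigenspaces

theorem inner_toEuclideanCLM_of_unitary {U : Matrix (Fin d) (Fin d) ℂ} (hU : Uᴴ * U = 1)
    (x y : EuclideanSpace ℂ (Fin d)) :
    inner ℂ (toEuclideanCLM (𝕜 := ℂ) U x) (toEuclideanCLM (𝕜 := ℂ) U y) = inner ℂ x y := by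
  rw [← ContinuousLinearMap.adjoint_inner_right, ← ContinuousLinearMap.star_eq_adjoint, ← map_star,
    ← mul_apply_eq_comp, ← map_mul, star_eq_conjTranspose, hU, map_one,
    one_apply_eq_self]

/-- The eigenspaces of a unitary intertwiner form an orthogonal decomposition for which the block
patterns of the tuple carry a potential. -/
theorem exists_decomposition_of_intertwiner {A : Fin g → Matrix (Fin d) (Fin d) ℂ}
    {γ : Fin g → Circle} {U : Matrix (Fin d) (Fin d) ℂ} (hU : Uᴴ * U = 1)
    (hUA : ∀ s, A s * U = (γ s : ℂ) • (U * A s)) :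
    ∃ (m : ℕ) (H : Fin m → Submodule ℂ (EuclideanSpace ℂ (Fin d))) (θ : Fin m → Circle),
      IsOrthogonalDecomposition H ∧
      ∀ s u v, (u, v) ∈ blockPattern H (A s) → θ v = γ s * θ u := by
  let f : Module.End ℂ (EuclideanSpace ℂ (Fin d)) := (toEuclideanCLM (𝕜 := ℂ) U).toLinearMap
  have hf : ∀ x y, inner ℂ (f x) (f y) = inner ℂ x y := inner_toEuclideanCLM_of_unitary hU
  have : Finite {μ : ℂ // f.HasEigenvalue μ} := inferInstanceAs (Finite (Module.End.Eigenvalues f))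
  have := Fintype.ofFinite {μ : ℂ // f.HasEigenvalue μ}
  let e := (Fintype.equivFin {μ : ℂ // f.HasEigenvalue μ}).symm
  have hθ : ∀ k, ‖(e k : ℂ)‖ = 1 := by
    intro k
    obtain ⟨x, hx⟩ := (e k).2.exists_hasEigenvector
    have h1 := star_mul_self_of_eigenvector hf hx.apply_eq_smul hx.2
    rw [RCLike.star_def, Complex.conj_mul'] at h1
    have h2 : ‖(e k : ℂ)‖ ^ 2 = 1 := by exact_mod_cast h1
    exact (pow_eq_one_iff_of_nonneg (norm_nonneg _) two_ne_zero).mp h2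
  refine ⟨_, fun k => f.eigenspace (e k), fun k => ⟨e k, mem_sphere_zero_iff_norm.mpr (hθ k)⟩,
    ⟨fun j k hjk => ?_, ?_⟩, fun s j k hjk => ?_⟩
  · rw [Submodule.isOrtho_iff_inner_eq]
    intro x hx y hy
    refine inner_eq_zero_of_eigenvectors hf ?_ (Module.End.mem_eigenspace_iff.mp hx)
      (Module.End.mem_eigenspace_iff.mp hy)
    exact fun h => hjk (e.injective (Subtype.ext h))
  · rw [eq_top_iff, ← (isSemisimple_of_inner_map_map hf).iSup_eigenspace_eq_top]
    refine iSup_le fun μ => ?_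
    by_cases hμ : f.HasEigenvalue μ
    · refine le_iSup_of_le (e.symm ⟨μ, hμ⟩) ?_
      rw [Equiv.apply_symm_apply]
    · rw [Module.End.hasEigenvalue_iff, not_not] at hμ
      rw [hμ]
      exact bot_le
  · by_contra hne
    apply hjk
    change block _ (A s) j k = 0
    ext1 x
    rw [block, ContinuousLinearMap.comp_apply, ContinuousLinearMap.comp_apply,
      _root_.zero_apply]
    rw [Submodule.orthogonalProjectionOnto_eq_zero_iff, Submodule.mem_orthogonal]
    intro y hy
    have hx := Module.End.mem_eigenspace_iff.mp x.2
    have hy' := Module.End.mem_eigenspace_iff.mp hy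
    -- `A s` sends the eigenspace of `μ` into that of `star (γ s) * μ`, hence is orthogonal to every
    -- other eigenspace.
    have hcomm : f (toEuclideanCLM (𝕜 := ℂ) (A s) (x : EuclideanSpace ℂ (Fin d)))
        = (star (γ s : ℂ) * e k) • toEuclideanCLM (𝕜 := ℂ) (A s) (x : EuclideanSpace ℂ (Fin d)) := by
      have h1 : U * A s = star (γ s : ℂ) • (A s * U) := by
        rw [hUA, smul_smul, Intertwines.star_coe_mul_coe, one_smul]
      change (toEuclideanCLM (𝕜 := ℂ) U) _ = _
      rw [← mul_apply_eq_comp, ← map_mul, h1, map_smul, map_mul,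
        _root_.smul_apply, mul_apply_eq_comp, mul_smul]
      congr 1
      change toEuclideanCLM (𝕜 := ℂ) (A s) (f x) = _
      rw [hx, map_smul]
    refine inner_eq_zero_of_eigenvectors hf ?_ hy' hcomm
    intro heq
    apply hne
    refine Circle.ext ?_
    change (e k : ℂ) = γ s * (e j : ℂ)
    rw [heq, ← mul_assoc, mul_comm (γ s : ℂ), Intertwines.star_coe_mul_coe, one_mul]

/-- An orthogonal decomposition with a potential on the block patterns gives a unitary intertwiner. -/
theorem exists_intertwiner_of_decomposition {A : Fin g → Matrix (Fin d) (Fin d) ℂ}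
    {H : Fin m → Submodule ℂ (EuclideanSpace ℂ (Fin d))} (hH : IsOrthogonalDecomposition H)
    {γ : Fin g → Circle} {θ : Fin m → Circle}
    (hθ : ∀ s u v, (u, v) ∈ blockPattern H (A s) → θ v = γ s * θ u) :
    ∃ U : Matrix (Fin d) (Fin d) ℂ, Uᴴ * U = 1 ∧ ∀ s, A s * U = (γ s : ℂ) • (U * A s) := by
  let τ := toEuclideanCLM (𝕜 := ℂ) (n := Fin d)
  let π := fun k => (H k).starProjection
  have hfam : OrthogonalFamily ℂ (fun k => H k) fun k => (H k).subtypeₗᵢ := by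
    rw [OrthogonalFamily]
    intro j k hjk x y
    exact (Submodule.isOrtho_iff_inner_eq.mp (hH.orthogonal j k hjk)) x x.2 y y.2
  have hsum : ∑ k, π k = 1 := by
    ext1 x
    rw [_root_.sum_apply, one_apply_eq_self]
    exact hfam.sum_projection_of_mem_iSup x (hH.span ▸ Submodule.mem_top)
  have hstar : ∀ k, star (π k) = π k := fun k => (isSelfAdjoint_starProjection (H k)).star_eq
  have hidem : ∀ k, π k * π k = π k := fun k => (Submodule.isIdempotentElem_starProjection (H k)).eq
  have horth : ∀ j k, j ≠ k → π j * π k = 0 := by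
    intro j k hjk
    exact Submodule.IsOrtho.starProjection_comp_starProjection (hH.orthogonal j k hjk)
  have hblock : ∀ s j k, π j * τ (A s) * π k ≠ 0 → (j, k) ∈ blockPattern H (A s) := by
    intro s j k hne h0
    apply hne
    ext1 x
    have := congrArg (fun y : H j => (y : EuclideanSpace ℂ (Fin d)))
      (DFunLike.congr_fun h0 ((H k).orthogonalProjectionOnto x))
    exact this
  -- The unitary acts on each summand as the value of the potential; the intertwining relation is
  -- checked block by block.
  let u := ∑ k, (θ k : ℂ) • π k
  have hu : star u * u = 1 := by
    simp only [u, star_sum, star_smul, hstar, Finset.sum_mul, Finset.mul_sum, smul_mul_smul_comm]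
    rw [← hsum]
    refine Finset.sum_congr rfl fun j _ => ?_
    rw [Finset.sum_eq_single j]
    · rw [Intertwines.star_coe_mul_coe, one_smul, hidem]
    · intro k _ hkj
      rw [horth _ _ hkj, smul_zero]
    · simp
  have huA : ∀ s, τ (A s) * u = (γ s : ℂ) • (u * τ (A s)) := by
    intro s
    calc τ (A s) * u = (∑ j, π j) * (τ (A s) * u) := by rw [hsum, one_mul]
      _ = ∑ j, ∑ k, (θ k : ℂ) • (π j * τ (A s) * π k) := by
        simp only [u, Finset.sum_mul, Finset.mul_sum, mul_smul_comm, mul_assoc, Finset.smul_sum]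
        exact Finset.sum_comm
      _ = ∑ j, ∑ k, ((γ s : ℂ) * θ j) • (π j * τ (A s) * π k) := by
        refine Finset.sum_congr rfl fun j _ => Finset.sum_congr rfl fun k _ => ?_
        by_cases h : π j * τ (A s) * π k = 0
        · rw [h, smul_zero, smul_zero]
        · rw [hθ s j k (hblock s j k h), Circle.coe_mul]
      _ = (γ s : ℂ) • (u * τ (A s) * ∑ k, π k) := by
        simp only [u, Finset.sum_mul, Finset.mul_sum, smul_mul_assoc, Finset.smul_sum, smul_smul]
        exact Finset.sum_comm
      _ = _ := by rw [hsum, mul_one]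
  refine ⟨τ.symm u, ?_, fun s => ?_⟩
  · apply (EquivLike.injective τ)
    rw [map_mul, ← star_eq_conjTranspose, map_star, StarAlgEquiv.apply_symm_apply, hu, map_one]
  · apply (EquivLike.injective τ)
    rw [map_mul, map_smul, map_mul, StarAlgEquiv.apply_symm_apply, huA]

/-- The rotated tuple is `Uᴴ * A s * U`, so the pencil at the rotated point is a unitary conjugate
of the pencil at `X`. -/
theorem isReinhardt_of_intertwiners {A : Fin g → Matrix (Fin d) (Fin d) ℂ}
    (h : ∀ γ : Fin g → Circle, ∃ U : Matrix (Fin d) (Fin d) ℂ, Uᴴ * U = 1 ∧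
      ∀ s, A s * U = (γ s : ℂ) • (U * A s)) : IsReinhardt (freeSpectrahedron A) := by
  intro n X hX γ
  obtain ⟨U, hU, hUA⟩ := h γ
  rw [mem_freeSpectrahedron, pencil_smul_comm]
  have : (fun s => (γ s : ℂ) • A s) = fun s => Uᴴ * A s * U := by
    ext1 s
    rw [Matrix.mul_assoc, hUA, Matrix.mul_smul, ← Matrix.mul_assoc, hU, Matrix.one_mul]
  rw [this, pencil_compress hU]
  exact hX.conjTranspose_mul_mul_same _

theorem IsReinhardt.exists_unitary {A : Fin g → Matrix (Fin d) (Fin d) ℂ}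
    (hmin : IsMinimalDefiningTuple A (freeSpectrahedron A))
    (hR : IsReinhardt (freeSpectrahedron A)) (γ : Fin g → Circle) :
    ∃ U : Matrix (Fin d) (Fin d) ℂ, Uᴴ * U = 1 ∧ ∀ s, A s * U = (γ s : ℂ) • (U * A s) := by
  rcases Nat.eq_zero_or_pos d with rfl | hd
  · exact ⟨1, Subsingleton.elim _ _, fun s => Subsingleton.elim _ _⟩
  · obtain ⟨V, hV, hVA⟩ := hR.exists_kraus hd γ
    obtain ⟨U, hUA, hU⟩ := exists_unitary_intertwiner hmin hV
      fun i s => kraus_intertwines hmin hR hV hVA s i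
    exact ⟨U, hU, fun s => (hUA s).1⟩

end Decompositions

end FreeReinhardt

theorem theorem3p1 {g d : ℕ} (A : Fin g → Matrix (Fin d) (Fin d) ℂ)
    (hmin : FreeReinhardt.IsMinimalDefiningTuple A (FreeReinhardt.freeSpectrahedron A))
    (hA : ∀ s, A s ≠ 0) :
    FreeReinhardt.IsReinhardt (FreeReinhardt.freeSpectrahedron A) ↔
      ∃ (m : ℕ) (H : Fin m → Submodule ℂ (EuclideanSpace ℂ (Fin d))),
        FreeReinhardt.IsOrthogonalDecomposition H ∧
        FreeReinhardt.IsDag (⋃ s, FreeReinhardt.blockPattern H (A s)) ∧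
        FreeReinhardt.IsReinhardtPartition (⋃ s, FreeReinhardt.blockPattern H (A s))
          (fun s => FreeReinhardt.blockPattern H (A s)) := by
  open FreeReinhardt in
  constructor
  · intro hR
    -- A single generic `γ` captures all conditions on the graph, while the converse needs a
    -- potential for every `γ`.
    obtain ⟨γ, hγ⟩ := exists_circle_independent g
    obtain ⟨U, hU, hUA⟩ := hR.exists_unitary hmin γ
    obtain ⟨m, H, θ, hH, hθ⟩ := exists_decomposition_of_intertwiner hU hUA
    exact ⟨m, H, hH, isDag_of_potential hγ hθ, isReinhardtPartition_of_potential hγ hθ⟩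
  · rintro ⟨m, H, hH, hdag, hpart⟩
    refine isReinhardt_of_intertwiners fun γ => ?_
    obtain ⟨θ, hθ⟩ := hpart.exists_potential hdag γ
    exact exists_intertwiner_of_decomposition hH hθ
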